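/- Let $1\le d\le N$. Let $\mathcal O_{N/d}$ be the set of $N\times N$ Hermitian matrices whose eigenvalues, in non-increasing order, are $N/d$ ($d$ times) and $0$ ($N-d$ times). It is a single orbit of $U(N)$ acting by conjugation on Hermitian matrices, and an embedded submanifold of the space of matrices with tangent space $\{[\eta,\xi]:\eta\in\mathfrak u(N)\}$ at $\xi$. Identify a Hermitian matrix $\xi$ with the functional $\alpha_\xi(\eta)=\tfrac{i}{2}\operatorname{tr}(\eta^*\xi)$ on $\mathfrak u(N)$, and equip $\mathcal O_{N/d}$ with the Kirillov–Kostant–Souriau symplectic form $$\omega_\xi([\eta,\xi],[\eta',\xi])=\alpha_\xi([\eta,\eta']).$$ Let $\mathcal F_{N/d}=\{F\in\mathbb C^{d\times N}: FF^*=\tfrac Nd I_d\}$ be the space of $N/d$-tight frames $F=[f_1|\cdots|f_N]$, with $U(d)$ acting by left multiplication and $U(1)^N$ (the diagonal unitary matrices $D$) acting by $D\cdot F=FD^*$. The map $[F]\mapsto F^*F$ identifies $\mathcal F_{N/d}/U(d)$ with $\mathcal O_{N/d}$: it is a homeomorphism; at each $F$ the differential of $F\mapsto F^*F$ maps the tangent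 space $\{X: XF^*+FX^*=0\}$ of $\mathcal F_{N/d}$ onto that of $\mathcal O_{N/d}$, with kernel $\mathfrak u(d)F$; $\omega$ pulls back to the restriction of the standard symplectic form $(X,Y)\mapsto-\operatorname{Im}\operatorname{tr}(Y^*X)$; and the action of $U(1)^N$ corresponds to $D\cdot\xi=D\xi D^*$. The scalars $U(1)\subset U(1)^N$ act trivially on $\mathcal O_{N/d}$. Let $G=U(1)^N/U(1)$, identified with the diagonal unitary matrices whose $(N,N)$ entry is $1$, and identify $\mathfrak g^*$ with $\mathbb R^{N-1}$ by letting $x\in\mathbb R^{N-1}$ be the functional $\operatorname{diag}(i\theta_1,\dots,i\theta_{N-1},0)\mapsto\tfrac12\sum_{k=1}^{N-1}x_k\theta_k$. Then the action of $G$ on the symplectic manifold $(\mathcal O_{N/d},\omega)$ by conjugation, which is effective if $d<N$, is Hamiltonian with momentum map $$\Phi_G:\mathcal O_{N/d}\to\mathbb R^{N-1}\cong\mathfrak g^*,\qquad \Phi_G(F^*F)=(\|f_1\|^2,\dots,\|f_{N-1}\|^2).$$ That is: $\omega$ is a smooth, closed, nondegenerate $2$-form; the action is smooth and preserves $\omega$;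 and for every $v\in\mathfrak g$, with $X^v_p=\frac{d}{dt}\big|_{t=0}\exp(tv)\cdot p$ and $\Phi^v(p)=\Phi_G(p)(v)$, the function $\Phi^v$ is smooth and $\omega(X^v,\cdot)=d\Phi^v$; and $\Phi_G$ is equivariant for the coadjoint action, $\Phi_G(g\cdot p)=\operatorname{Ad}^*_g\Phi_G(p)$. -/

import Mathlib

open scoped Manifold ContDiff Matrix Matrix.Norms.L2Operator

noncomputable section

/-! ### Symplectic manifolds and Hamiltonian actions -/

section Symplectic

variable {E : Type*} [NormedAddCommGroup E] [NormedSpace ℝ E]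
  {M : Type*} [TopologicalSpace M] [ChartedSpace E M]

variable (E M) in
/-- A (not necessarily smooth) differential `2`-form on a manifold `M` modelled on `E`. -/
abbrev TwoForm : Type _ := ∀ p : M, TangentSpace 𝓘(ℝ, E) p [⋀^Fin 2]→L[ℝ] ℝ

/-- The form `Ω` read in the preferred chart at `p`: its pullback along the inverse chart. -/
def TwoForm.inChart (Ω : TwoForm E M) (p : M) (y : E) : E [⋀^Fin 2]→L[ℝ] ℝ :=
  (Ω ((chartAt E p).symm y)).compContinuousLinearMap
    (mfderiv 𝓘(ℝ, E) 𝓘(ℝ, E) (chartAt E p).symm y)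

/-- `(M, Ω)` is a symplectic manifold. -/
structure IsSymplectic (Ω : TwoForm E M) : Prop where
  isManifold : IsManifold 𝓘(ℝ, E) ∞ M
  smooth : ∀ p, ContDiffOn ℝ ∞ (Ω.inChart p) (chartAt E p).target
  closed : ∀ p, ∀ y ∈ (chartAt E p).target, extDeriv (Ω.inChart p) y = 0
  nondegenerate : ∀ (p : M) (X : TangentSpace 𝓘(ℝ, E) p),
    (∀ Y : TangentSpace 𝓘(ℝ, E) p, Ω p ![X, Y] = 0) → X = 0

variable {E' H' G : Type*} [NormedAddCommGroup E'] [NormedSpace ℝ E'] [TopologicalSpace H']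
  (I : ModelWithCorners ℝ E' H') [Group G] [TopologicalSpace G] [ChartedSpace H' G]

/-- The adjoint action of `g` on the Lie algebra: the differential at `1` of `h ↦ g h g⁻¹`. -/
def lieAd (g : G) (v : GroupLieAlgebra I G) : GroupLieAlgebra I G :=
  (mfderiv I I (fun h : G => g * h * g⁻¹) 1 v : E')

variable [MulAction G M]

/-- The vector field on `M` generated by `v` in the Lie algebra: at `p` it is the differential at
`1` of `g ↦ g • p`, applied to `v`, that is, `d/dt (exp (t v) • p)` at `t = 0`. -/
def fundamentalField (v : GroupLieAlgebra I G) (p : M) : TangentSpace 𝓘(ℝ, E) p :=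
  (mfderiv I 𝓘(ℝ, E) (fun g : G => g • p) 1 v : E)

/-- The action of the Lie group `G` on the symplectic manifold `(M, Ω)` is Hamiltonian with
momentum map `Φ`. -/
structure IsHamiltonianAction [LieGroup I ∞ G] (Ω : TwoForm E M)
    (Φ : M → (GroupLieAlgebra I G →L[ℝ] ℝ)) : Prop where
  isSymplectic : IsSymplectic Ω
  smooth_smul : ContMDiffSMul I 𝓘(ℝ, E) ∞ G M
  invariant : ∀ (g : G) (p : M) (X Y : TangentSpace 𝓘(ℝ, E) p),
    Ω (g • p) ![mfderiv 𝓘(ℝ, E) 𝓘(ℝ, E) (fun q : M => g • q) p X,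
      mfderiv 𝓘(ℝ, E) 𝓘(ℝ, E) (fun q : M => g • q) p Y] = Ω p ![X, Y]
  smooth_momentum : ∀ v, ContMDiff 𝓘(ℝ, E) 𝓘(ℝ, ℝ) ∞ (fun p => Φ p v)
  hamilton : ∀ (v : GroupLieAlgebra I G) (p : M) (Y : TangentSpace 𝓘(ℝ, E) p),
    Ω p ![fundamentalField I v p, Y] = (mfderiv 𝓘(ℝ, E) 𝓘(ℝ, ℝ) (fun q => Φ q v) p Y : ℝ)
  equivariant : ∀ (g : G) (p : M) (v : GroupLieAlgebra I G), Φ (g • p) v = Φ p (lieAd I g⁻¹ v)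

end Symplectic

/-! ### Tori as Lie groups -/

section Torus
variable {ι : Type} [Fintype ι]
/-- The model with corners of the torus `U(1)^ι`. -/
abbrev torusModel (ι : Type) [Fintype ι] :=
  ModelWithCorners.pi (fun _ : ι => 𝓡 1)

theorem contMDiff_torus_iff {E H M : Type*} [NormedAddCommGroup E] [NormedSpace ℝ E]
    [TopologicalSpace H] {I : ModelWithCorners ℝ E H} [TopologicalSpace M] [ChartedSpace H M]
    {f : M → ι → Circle} :
    ContMDiff I (torusModel ι) ∞ f ↔ ∀ i, ContMDiff I (𝓡 1) ∞ (fun x => f x i) := by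
  simp only [ContMDiff]
  rw [forall_comm]
  refine forall_congr' fun x => ?_
  simp only [contMDiffAt_iff, continuousAt_pi, forall_and]
  refine and_congr Iff.rfl ?_
  rw [contDiffWithinAt_pi]
  rfl

instance : IsManifold (torusModel ι) ∞ (ι → Circle) := by
  apply isManifold_of_contDiffOn
  rintro e e' ⟨f, hf, rfl⟩ ⟨f', hf', rfl⟩
  rw [contDiffOn_pi]
  intro i
  have h := (contDiffGroupoid ∞ (𝓡 1)).compatible (hf i trivial) (hf' i trivial)
  rw [contDiffGroupoid, mem_groupoid_of_pregroupoid] at h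
  have h1 : ContDiffOn ℝ ∞ _ _ := h.1
  refine h1.comp (contDiff_apply ℝ _ i).contDiffOn ?_
  rintro x ⟨hx, -⟩
  refine ⟨?_, by simp⟩
  have hx1 := hx.1
  have hx2 := hx.2
  exact ⟨hx1 i trivial, hx2 i trivial⟩

theorem contMDiff_torus_apply (i : ι) :
    ContMDiff (torusModel ι) (𝓡 1) ∞ (fun g : ι → Circle => g i) :=
  contMDiff_torus_iff.1 contMDiff_id i

instance : LieGroup (torusModel ι) ∞ (ι → Circle) where
  contMDiff_mul := contMDiff_torus_iff.2 fun i =>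
    ((contMDiff_torus_apply i).comp contMDiff_fst).mul ((contMDiff_torus_apply i).comp contMDiff_snd)
  contMDiff_inv := contMDiff_torus_iff.2 fun i => (contMDiff_torus_apply i).inv
end Torus

/-! ### The orbit as a manifold -/

/-- `ξ` is Hermitian and its eigenvalues, in non-increasing order, are `N / d` (the first `d` of
them) and `0` (the remaining ones). -/
def IsOrbitMatrix (d N : ℕ) (ξ : Matrix (Fin N) (Fin N) ℂ) : Prop :=
  ∃ h : ξ.IsHermitian, ∀ i, h.eigenvalues₀ i = if (i : ℕ) < d then (N : ℝ) / d else 0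

theorem step_of_antitone {m d : ℕ} {c : ℝ} (hc : 0 < c) (f : Fin m → ℝ) (hf : Antitone f)
    (h01 : ∀ i, f i = 0 ∨ f i = c) (hs : ∑ i, f i = d * c) (i : Fin m) :
    f i = if (i : ℕ) < d then c else 0 := by
  classical
  set S := Finset.univ.filter (fun i => f i = c) with hS
  have hcard : S.card = d := by
    have h1 : ∑ i, f i = ∑ i, if f i = c then c else 0 := by
      refine Finset.sum_congr rfl fun i _ => ?_
      rcases h01 i with h | h <;> simp [h, hc.ne]
    rw [h1, ← Finset.sum_filter, Finset.sum_const, nsmul_eq_mul] at hs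
    exact_mod_cast mul_right_cancel₀ hc.ne' hs
  rcases h01 i with h | h
  · have : S ⊆ Finset.Iio i := by
      intro j hj
      rw [Finset.mem_Iio]
      by_contra hij
      have := hf (not_lt.1 hij)
      simp [hS] at hj
      linarith
    have := Finset.card_le_card this
    rw [hcard, Fin.card_Iio] at this
    simp [h, not_lt.2 this]
  · have : Finset.Iic i ⊆ S := by
      intro j hj
      have := hf (Finset.mem_Iic.1 hj)
      rcases h01 j with h' | h'
      · linarith
      · simp [hS, h']
    have := Finset.card_le_card this
    rw [hcard, Fin.card_Iic] at this
    simp [h, Nat.lt_of_succ_le this]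

theorem isOrbitMatrix_iff {d N : ℕ} (hd : 0 < d) (hN : d ≤ N) (ξ : Matrix (Fin N) (Fin N) ℂ) :
    IsOrbitMatrix d N ξ ↔
      ξ.IsHermitian ∧ ξ * ξ = ((N : ℂ) / d) • ξ ∧ ξ.trace = N := by
  have hc : 0 < (N : ℝ) / d := by
    have : 0 < N := by omega
    positivity
  have hsum : ∀ h : ξ.IsHermitian, ∑ i, h.eigenvalues i = ∑ i, h.eigenvalues₀ i := fun h =>
    Equiv.sum_comp (Fintype.equivOfCardEq (Fintype.card_fin _)).symm h.eigenvalues₀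
  constructor
  · rintro ⟨h, he⟩
    have he' : ∀ i, h.eigenvalues i = 0 ∨ h.eigenvalues i = N / d := by
      intro i
      simp only [Matrix.IsHermitian.eigenvalues, he]
      split_ifs <;> simp
    refine ⟨h, ?_, ?_⟩
    · have hs := h.spectral_theorem
      generalize hV : Unitary.conjStarAlgAut ℂ (Matrix (Fin N) (Fin N) ℂ) h.eigenvectorUnitary = φ
        at hs
      conv_lhs => rw [hs]
      conv_rhs => rw [hs]
      rw [← map_mul, ← map_smul, Matrix.diagonal_mul_diagonal, ← Matrix.diagonal_smul]
      congr 2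
      ext i
      rcases he' i with h | h <;> simp [h]
    · rw [h.trace_eq_sum_eigenvalues]
      have : ∑ i, h.eigenvalues i = N := by
        rw [hsum, Finset.sum_congr rfl fun i _ => he i, ← Finset.sum_filter, Finset.sum_const]
        have : (Finset.univ.filter fun i : Fin (Fintype.card (Fin N)) => (i : ℕ) < d).card = d := by
          rw [Fin.card_filter_val_lt]; simp [hN]
        rw [this, nsmul_eq_mul]
        field_simp
      rw [← RCLike.ofReal_sum, this]
      simp
  · rintro ⟨h, h2, ht⟩
    refine ⟨h, step_of_antitone hc _ h.eigenvalues₀_antitone ?_ ?_⟩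
    · suffices ∀ i, h.eigenvalues i = 0 ∨ h.eigenvalues i = N / d by
        intro i
        simpa [Matrix.IsHermitian.eigenvalues] using
          this (Fintype.equivOfCardEq (Fintype.card_fin _) i)
      intro i
      have hv := h.mulVec_eigenvectorBasis i
      set v := (h.eigenvectorBasis i).ofLp with hvdef
      have h3 : (ξ * ξ) *ᵥ v = (((N : ℂ) / d) • ξ) *ᵥ v := by rw [h2]
      rw [← Matrix.mulVec_mulVec, Matrix.smul_mulVec, hv, Matrix.mulVec_smul, hv] at h3
      have hv0 : v ≠ 0 := by
        intro h0
        have := h.eigenvectorBasis.orthonormal.ne_zero i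
        apply this
        ext k
        exact congrFun h0 k
      obtain ⟨k, hk⟩ := Function.ne_iff.1 hv0
      have h4 := congrFun h3 k
      simp at h4 hk
      rcases h4 with h4 | h4 | h4
      · exact Or.inr (by simpa using congrArg Complex.re h4)
      · exact Or.inl h4
      · exact absurd h4 hk
    · rw [← hsum]
      have := h.trace_eq_sum_eigenvalues
      rw [ht] at this
      have : (N : ℝ) = ∑ i, h.eigenvalues i := by
        rw [← RCLike.ofReal_sum] at this
        simpa using congrArg Complex.re this
      rw [← this]
      field_simp

/-- The orbit `𝒪_{N/d}`, with the topology of a subspace of the `N × N` matrices. -/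
def Orbit (d N : ℕ) : Type := {ξ : Matrix (Fin N) (Fin N) ℂ // IsOrbitMatrix d N ξ}

namespace Orbit
variable {d N : ℕ}
/-- The inclusion of `𝒪_{N/d}` into the space of matrices. -/
def incl (ξ : Orbit d N) : Matrix (Fin N) (Fin N) ℂ := ξ.1

instance : TopologicalSpace (Orbit d N) := instTopologicalSpaceSubtype

theorem continuous_incl : Continuous (incl : Orbit d N → _) := continuous_subtype_val

end Orbit

/-- An orthonormal basis of `ℂ^N`, the columns of `A` (the first `d` vectors) and of `B` (the other
`N - d`). Each one gives a chart of `𝒪_{N/d}`. -/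
structure Splitting (d N : ℕ) where
  A : Matrix (Fin N) (Fin d) ℂ
  B : Matrix (Fin N) (Fin (N - d)) ℂ
  hAA : Aᴴ * A = 1
  hBB : Bᴴ * B = 1
  hAB : Aᴴ * B = 0
  hsum : A * Aᴴ + B * Bᴴ = 1

/-- The real vector space on which `𝒪_{N/d}` is modelled. -/
abbrev OrbitModel (d N : ℕ) : Type := Matrix (Fin (N - d)) (Fin d) ℂ

namespace Splitting
variable {d N : ℕ}
theorem hBA (s : Splitting d N) : s.Bᴴ * s.A = 0 := by
  simpa using congrArg Matrix.conjTranspose s.hAB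

theorem exists_of_isOrbitMatrix (hN : d ≤ N) {ξ : Matrix (Fin N) (Fin N) ℂ}
    (hξ : IsOrbitMatrix d N ξ) : ∃ s : Splitting d N, ξ = ((N : ℂ) / d) • (s.A * s.Aᴴ) := by
  obtain ⟨h, he⟩ := hξ
  let e₀ : Fin d ⊕ Fin (N - d) ≃ Fin (Fintype.card (Fin N)) :=
    finSumFinEquiv.trans (finCongr (by simp; omega))
  let σ : Fin d ⊕ Fin (N - d) ≃ Fin N := e₀.trans (Fintype.equivOfCardEq (Fintype.card_fin _))
  have hl : ∀ i, h.eigenvalues (σ (Sum.inl i)) = N / d := by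
    intro i; simp [Matrix.IsHermitian.eigenvalues, σ, he, e₀]
  have hr : ∀ i, h.eigenvalues (σ (Sum.inr i)) = 0 := by
    intro i; simp [Matrix.IsHermitian.eigenvalues, σ, he, e₀]
  let U : Matrix (Fin N) (Fin N) ℂ := h.eigenvectorUnitary
  have hU1 : Uᴴ * U = 1 := Unitary.coe_star_mul_self h.eigenvectorUnitary
  have hU2 : U * Uᴴ = 1 := Unitary.coe_mul_star_self h.eigenvectorUnitary
  let A : Matrix (Fin N) (Fin d) ℂ := U.submatrix id (fun i => σ (Sum.inl i))
  let B : Matrix (Fin N) (Fin (N - d)) ℂ := U.submatrix id (fun i => σ (Sum.inr i))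
  have hsum : ∀ f : Fin N → ℂ, ∑ k, f k = ∑ i, f (σ (Sum.inl i)) + ∑ i, f (σ (Sum.inr i)) := by
    intro f
    rw [← Equiv.sum_comp σ, Fintype.sum_sum_type]
  refine ⟨⟨A, B, ?_, ?_, ?_, ?_⟩, ?_⟩
  · ext i j
    have := congrFun (congrFun hU1 (σ (Sum.inl i))) (σ (Sum.inl j))
    simpa [Matrix.mul_apply, A, Matrix.one_apply] using this
  · ext i j
    have := congrFun (congrFun hU1 (σ (Sum.inr i))) (σ (Sum.inr j))
    simpa [Matrix.mul_apply, B, Matrix.one_apply] using this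
  · ext i j
    have := congrFun (congrFun hU1 (σ (Sum.inl i))) (σ (Sum.inr j))
    simpa [Matrix.mul_apply, A, B, Matrix.one_apply] using this
  · ext i j
    have := congrFun (congrFun hU2 i) j
    rw [Matrix.mul_apply, hsum] at this
    simpa [Matrix.mul_apply, A, B] using this
  · ext i j
    have := congrFun (congrFun h.spectral_theorem i) j
    rw [Unitary.conjStarAlgAut_apply, Matrix.mul_apply, hsum] at this
    simp only [Matrix.mul_diagonal, Function.comp, hl, hr] at this
    rw [this]
    simp only [Matrix.smul_apply, Matrix.mul_apply, A, U, smul_eq_mul, Finset.mul_sum]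
    simp
    refine Finset.sum_congr rfl fun k _ => by ring

/-- The columns of `A + B Z` span the graph of `Z : span A → span B`. -/
def graphFrame (s : Splitting d N) (Z : Matrix (Fin (N - d)) (Fin d) ℂ) :
    Matrix (Fin N) (Fin d) ℂ := s.A + s.B * Z

/-- `N / d` times the orthogonal projection onto the graph of `Z`. -/
def graphMatrix (s : Splitting d N) (Z : Matrix (Fin (N - d)) (Fin d) ℂ) :
    Matrix (Fin N) (Fin N) ℂ :=
  ((N : ℂ) / d) • (s.graphFrame Z * (1 + Zᴴ * Z)⁻¹ * (s.graphFrame Z)ᴴ)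

/-- The matrix `Z` such that the range of `ξ` is the graph of `Z`, whenever `Aᴴ ξ A` is
invertible. -/
def coord (s : Splitting d N) (ξ : Matrix (Fin N) (Fin N) ℂ) :
    Matrix (Fin (N - d)) (Fin d) ℂ :=
  (s.Bᴴ * ξ * s.A) * (s.Aᴴ * ξ * s.A)⁻¹

theorem graphFrame_gram (s : Splitting d N) (Z : Matrix (Fin (N - d)) (Fin d) ℂ) :
    (s.graphFrame Z)ᴴ * s.graphFrame Z = 1 + Zᴴ * Z := by
  simp only [graphFrame, Matrix.conjTranspose_add, Matrix.conjTranspose_mul, Matrix.add_mul,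
    Matrix.mul_add, s.hAA]
  rw [Matrix.mul_assoc Zᴴ, s.hBA, ← Matrix.mul_assoc s.Aᴴ, s.hAB, Matrix.mul_assoc Zᴴ,
    ← Matrix.mul_assoc s.Bᴴ, s.hBB]
  simp

theorem A_graphFrame (s : Splitting d N) (Z : Matrix (Fin (N - d)) (Fin d) ℂ) :
    s.Aᴴ * s.graphFrame Z = 1 := by
  rw [graphFrame, Matrix.mul_add, s.hAA, ← Matrix.mul_assoc, s.hAB]; simp

theorem B_graphFrame (s : Splitting d N) (Z : Matrix (Fin (N - d)) (Fin d) ℂ) :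
    s.Bᴴ * s.graphFrame Z = Z := by
  rw [graphFrame, Matrix.mul_add, s.hBA, ← Matrix.mul_assoc, s.hBB]; simp

open scoped ComplexOrder in
theorem isUnit_gram (Z : Matrix (Fin (N - d)) (Fin d) ℂ) : IsUnit (1 + Zᴴ * Z).det := by
  rw [← Matrix.isUnit_iff_isUnit_det]
  exact (Matrix.PosDef.one.add_posSemidef (Matrix.posSemidef_conjTranspose_mul_self Z)).isUnit

theorem scale_ne_zero (hd : 0 < d) (hN : d ≤ N) : (N : ℂ) / d ≠ 0 := by
  have h1 : (N : ℂ) ≠ 0 := by exact_mod_cast (by omega : N ≠ 0)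
  have h2 : (d : ℂ) ≠ 0 := by exact_mod_cast hd.ne'
  exact div_ne_zero h1 h2

theorem isOrbitMatrix_graphMatrix (hd : 0 < d) (hN : d ≤ N) (s : Splitting d N)
    (Z : Matrix (Fin (N - d)) (Fin d) ℂ) : IsOrbitMatrix d N (s.graphMatrix Z) := by
  have hd' : (d : ℂ) ≠ 0 := by exact_mod_cast hd.ne'
  have hu := isUnit_gram Z
  have hg := s.graphFrame_gram Z
  have hK : ((1 + Zᴴ * Z)⁻¹)ᴴ = (1 + Zᴴ * Z)⁻¹ := by
    rw [Matrix.conjTranspose_nonsing_inv]; simp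
  rw [isOrbitMatrix_iff hd hN, graphMatrix]
  generalize s.graphFrame Z = W at *
  generalize 1 + Zᴴ * Z = K at *
  refine ⟨?_, ?_, ?_⟩
  · rw [Matrix.IsHermitian, Matrix.conjTranspose_smul]
    simp [Matrix.conjTranspose_mul, hK, Matrix.mul_assoc]
  · rw [Matrix.smul_mul, Matrix.mul_smul]
    congr 2
    calc W * K⁻¹ * Wᴴ * (W * K⁻¹ * Wᴴ) = W * K⁻¹ * ((Wᴴ * W) * K⁻¹) * Wᴴ := by
          simp only [Matrix.mul_assoc]
      _ = _ := by rw [hg, Matrix.mul_nonsing_inv _ hu, Matrix.mul_one]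
  · rw [Matrix.trace_smul, Matrix.trace_mul_comm, ← Matrix.mul_assoc, hg,
      Matrix.mul_nonsing_inv _ hu, Matrix.trace_one]
    simp
    field_simp

theorem coord_graphMatrix (hd : 0 < d) (hN : d ≤ N) (s : Splitting d N)
    (Z : Matrix (Fin (N - d)) (Fin d) ℂ) :
    IsUnit (s.Aᴴ * s.graphMatrix Z * s.A).det ∧ s.coord (s.graphMatrix Z) = Z := by
  have hc := scale_ne_zero hd hN
  have hu := isUnit_gram Z
  have hA := s.A_graphFrame Z
  have hB := s.B_graphFrame Z
  have hA' : (s.graphFrame Z)ᴴ * s.A = 1 := by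
    simpa using congrArg Matrix.conjTranspose hA
  have e1 : s.Aᴴ * s.graphMatrix Z * s.A = ((N : ℂ) / d) • (1 + Zᴴ * Z)⁻¹ := by
    rw [graphMatrix, Matrix.mul_smul, Matrix.smul_mul]
    congr 1
    rw [Matrix.mul_assoc, Matrix.mul_assoc _ _ s.A, hA', ← Matrix.mul_assoc, ← Matrix.mul_assoc, hA]
    simp
  have e2 : s.Bᴴ * s.graphMatrix Z * s.A = ((N : ℂ) / d) • (Z * (1 + Zᴴ * Z)⁻¹) := by
    rw [graphMatrix, Matrix.mul_smul, Matrix.smul_mul]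
    congr 1
    rw [Matrix.mul_assoc, Matrix.mul_assoc _ _ s.A, hA', ← Matrix.mul_assoc, ← Matrix.mul_assoc, hB]
    simp
  have hu2 : IsUnit (((N : ℂ) / d) • (1 + Zᴴ * Z)⁻¹).det := by
    rw [Matrix.det_smul]
    exact (IsUnit.mk0 _ (pow_ne_zero _ hc)).mul (Matrix.isUnit_nonsing_inv_det _ hu)
  refine ⟨e1 ▸ hu2, ?_⟩
  rw [coord, e1, e2, ← Matrix.mul_smul, Matrix.mul_assoc, Matrix.mul_nonsing_inv _ hu2,
    Matrix.mul_one]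

open scoped ComplexOrder in
theorem graphMatrix_coord (hd : 0 < d) (hN : d ≤ N) (s : Splitting d N)
    {ξ : Matrix (Fin N) (Fin N) ℂ} (hξ : IsOrbitMatrix d N ξ)
    (hu : IsUnit (s.Aᴴ * ξ * s.A).det) : s.graphMatrix (s.coord ξ) = ξ := by
  obtain ⟨hH, h2, ht⟩ := (isOrbitMatrix_iff hd hN ξ).1 hξ
  have hc := scale_ne_zero hd hN
  have hd' : (d : ℂ) ≠ 0 := by exact_mod_cast hd.ne'
  set c : ℂ := (N : ℂ) / d with hcdef
  set L := s.Aᴴ * ξ * s.A with hL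
  have hLH : (L⁻¹)ᴴ = L⁻¹ := by
    rw [Matrix.conjTranspose_nonsing_inv]
    congr 1
    simp [hL, hH.eq, Matrix.mul_assoc]
  have hW : s.graphFrame (s.coord ξ) = ξ * s.A * L⁻¹ := by
    have h1 : s.A * L = s.A * s.Aᴴ * (ξ * s.A) := by simp [hL, Matrix.mul_assoc]
    have h2 : s.A = s.A * s.Aᴴ * (ξ * s.A) * L⁻¹ := by
      rw [← h1, Matrix.mul_assoc, Matrix.mul_nonsing_inv _ hu, Matrix.mul_one]
    rw [graphFrame]
    conv_lhs => enter [1]; rw [h2]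
    have h3 : s.B * s.coord ξ = s.B * s.Bᴴ * (ξ * s.A) * L⁻¹ := by
      simp only [coord, hL, Matrix.mul_assoc]
    rw [h3, ← Matrix.add_mul, ← Matrix.add_mul, s.hsum, Matrix.one_mul]
  have hK : 1 + (s.coord ξ)ᴴ * s.coord ξ = c • L⁻¹ := by
    rw [← s.graphFrame_gram, hW]
    simp only [Matrix.conjTranspose_mul, hLH, hH.eq]
    calc L⁻¹ * (s.Aᴴ * ξ) * (ξ * s.A * L⁻¹) = L⁻¹ * (s.Aᴴ * (ξ * ξ) * s.A) * L⁻¹ := by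
          simp only [Matrix.mul_assoc]
      _ = c • (L⁻¹ * L * L⁻¹) := by
          rw [h2]; simp only [hL, Matrix.mul_smul, Matrix.smul_mul]
      _ = _ := by rw [Matrix.nonsing_inv_mul _ hu, Matrix.one_mul]
  have hKi : (c • L⁻¹)⁻¹ = c⁻¹ • L := by
    apply Matrix.inv_eq_right_inv
    rw [Matrix.smul_mul, Matrix.mul_smul, smul_smul, mul_inv_cancel₀ hc, one_smul,
      Matrix.nonsing_inv_mul _ hu]
  have hR : s.graphMatrix (s.coord ξ) = ξ * s.A * L⁻¹ * (s.Aᴴ * ξ) := by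
    rw [graphMatrix, hK, hKi, hW]
    simp only [Matrix.conjTranspose_mul, hLH, hH.eq, Matrix.mul_smul, Matrix.smul_mul, smul_smul,
      ← hcdef, mul_inv_cancel₀ hc, one_smul]
    rw [Matrix.mul_assoc _ L⁻¹ L, Matrix.nonsing_inv_mul _ hu, Matrix.mul_one, ← Matrix.mul_assoc]
  rw [hR]
  set R := ξ * s.A * L⁻¹ * (s.Aᴴ * ξ) with hRdef
  have hRH : Rᴴ = R := by
    simp [hRdef, Matrix.conjTranspose_mul, hLH, hH.eq, Matrix.mul_assoc]
  have hξR : ξ * R = c • R := by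
    rw [hRdef]
    simp only [← Matrix.mul_assoc]
    rw [h2]
    simp only [Matrix.smul_mul]
  have hRξ : R * ξ = c • R := by
    have h := congrArg Matrix.conjTranspose hξR
    rw [Matrix.conjTranspose_mul, hRH, hH.eq, Matrix.conjTranspose_smul, hRH] at h
    rw [h]
    simp [c]
  have hRR : R * R = c • R := by
    calc R * R = ξ * s.A * L⁻¹ * (s.Aᴴ * (ξ * R)) := by
          conv_lhs => enter [1]; rw [hRdef]
          simp only [Matrix.mul_assoc]
      _ = c • (ξ * s.A * L⁻¹ * (s.Aᴴ * R)) := by rw [hξR]; simp only [Matrix.mul_smul]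
      _ = c • (ξ * s.A * (L⁻¹ * L) * L⁻¹ * (s.Aᴴ * ξ)) := by
          rw [hRdef, hL]; simp only [Matrix.mul_assoc]
      _ = c • R := by rw [Matrix.nonsing_inv_mul _ hu, Matrix.mul_one]
  have htr : R.trace = N := by
    rw [hRdef, Matrix.trace_mul_comm]
    have : s.Aᴴ * ξ * (ξ * s.A * L⁻¹) = c • 1 := by
      calc s.Aᴴ * ξ * (ξ * s.A * L⁻¹) = s.Aᴴ * (ξ * ξ) * s.A * L⁻¹ := by
            simp only [Matrix.mul_assoc]
        _ = c • (L * L⁻¹) := by rw [h2]; simp only [hL, Matrix.mul_smul, Matrix.smul_mul]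
        _ = _ := by rw [Matrix.mul_nonsing_inv _ hu]
    rw [this, Matrix.trace_smul, Matrix.trace_one]
    simp [c]
    field_simp
  have h0 : ((R - ξ)ᴴ * (R - ξ)).trace = 0 := by
    have : (R - ξ)ᴴ * (R - ξ) = c • (ξ - R) := by
      rw [Matrix.conjTranspose_sub, hRH, hH.eq, Matrix.sub_mul, Matrix.mul_sub, Matrix.mul_sub,
        hRR, hRξ, hξR, h2, smul_sub]
      abel
    rw [this, Matrix.trace_smul, Matrix.trace_sub, htr, ht]
    simp
  exact sub_eq_zero.1 (Matrix.trace_conjTranspose_mul_self_eq_zero_iff.1 h0)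

theorem continuousOn_matrix_inv {X : Type*} [TopologicalSpace X] {m : ℕ} {f : X → Matrix (Fin m) (Fin m) ℂ}
    {t : Set X} (hf : ContinuousOn f t) (hu : ∀ x ∈ t, IsUnit (f x).det) :
    ContinuousOn (fun x => (f x)⁻¹) t := by
  have hdet : ContinuousOn (fun x => (f x).det) t :=
    (Continuous.matrix_det continuous_id).comp_continuousOn hf
  have hadj : ContinuousOn (fun x => (f x).adjugate) t :=
    (Continuous.matrix_adjugate continuous_id).comp_continuousOn hf
  simp only [Matrix.inv_def, Ring.inverse_eq_inv']
  exact (hdet.inv₀ fun x hx => (hu x hx).ne_zero).smul hadj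

theorem continuousOn_coord (s : Splitting d N) :
    ContinuousOn s.coord {ξ : Matrix (Fin N) (Fin N) ℂ | (s.Aᴴ * ξ * s.A).det ≠ 0} := by
  have h1 : Continuous fun ξ : Matrix (Fin N) (Fin N) ℂ => s.Aᴴ * ξ * s.A :=
    (continuous_const.matrix_mul continuous_id).matrix_mul continuous_const
  have h2 : Continuous fun ξ : Matrix (Fin N) (Fin N) ℂ => s.Bᴴ * ξ * s.A :=
    (continuous_const.matrix_mul continuous_id).matrix_mul continuous_const
  have h3 : ContinuousOn (fun ξ : Matrix (Fin N) (Fin N) ℂ => (s.Aᴴ * ξ * s.A)⁻¹)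
      {ξ : Matrix (Fin N) (Fin N) ℂ | (s.Aᴴ * ξ * s.A).det ≠ 0} :=
    continuousOn_matrix_inv h1.continuousOn (fun ξ hξ => IsUnit.mk0 _ hξ)
  rw [continuousOn_iff_continuous_domRestrict] at h3 ⊢
  exact (h2.comp continuous_subtype_val).matrix_mul h3

theorem continuous_graphMatrix (s : Splitting d N) : Continuous s.graphMatrix := by
  have hW : Continuous s.graphFrame :=
    continuous_const.add (continuous_const.matrix_mul continuous_id)
  have hK : Continuous fun Z : Matrix (Fin (N - d)) (Fin d) ℂ => 1 + Zᴴ * Z :=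
    continuous_const.add (continuous_id.matrix_conjTranspose.matrix_mul continuous_id)
  have hKi := continuousOn_univ.1
    (continuousOn_matrix_inv hK.continuousOn (t := Set.univ) fun Z _ => isUnit_gram Z)
  exact ((hW.matrix_mul hKi).matrix_mul hW.matrix_conjTranspose).const_smul ((N : ℂ) / d)

/-- The graph chart of `𝒪_{N/d}` belonging to a splitting; it is onto the space of
`(N - d) × d` matrices. -/
def chart [hd : Fact (0 < d)] [hN : Fact (d ≤ N)] (s : Splitting d N) :
    OpenPartialHomeomorph (Orbit d N) (Matrix (Fin (N - d)) (Fin d) ℂ) where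
  toFun ξ := s.coord ξ.incl
  invFun Z := ⟨s.graphMatrix Z, isOrbitMatrix_graphMatrix hd.out hN.out s Z⟩
  source := {ξ | (s.Aᴴ * ξ.incl * s.A).det ≠ 0}
  target := Set.univ
  map_source' _ _ := trivial
  map_target' Z _ := (coord_graphMatrix hd.out hN.out s Z).1.ne_zero
  left_inv' ξ hξ := Subtype.ext (graphMatrix_coord hd.out hN.out s ξ.2 (IsUnit.mk0 _ hξ))
  right_inv' Z _ := (coord_graphMatrix hd.out hN.out s Z).2
  open_source := by
    refine isOpen_ne_fun (Continuous.matrix_det ?_) continuous_const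
    exact (continuous_const.matrix_mul Orbit.continuous_incl).matrix_mul continuous_const
  open_target := isOpen_univ
  continuousOn_toFun := by
    exact s.continuousOn_coord.comp Orbit.continuous_incl.continuousOn fun _ h => h
  continuousOn_invFun := by
    exact (s.continuous_graphMatrix.subtype_mk _).continuousOn

end Splitting

namespace Orbit
variable {d N : ℕ}
/-- A splitting adapted to `ξ`: the columns of `A` span the range of `ξ`. -/
def splittingAt [hN : Fact (d ≤ N)] (ξ : Orbit d N) : Splitting d N :=
  (Splitting.exists_of_isOrbitMatrix hN.out ξ.2).choose

theorem splittingAt_spec [hN : Fact (d ≤ N)] (ξ : Orbit d N) :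
    ξ.incl = ((N : ℂ) / d) • (ξ.splittingAt.A * ξ.splittingAt.Aᴴ) :=
  (Splitting.exists_of_isOrbitMatrix hN.out ξ.2).choose_spec

/-- The atlas of all graph charts. -/
instance [hd : Fact (0 < d)] [hN : Fact (d ≤ N)] : ChartedSpace (OrbitModel d N) (Orbit d N) where
  atlas := Set.range Splitting.chart
  chartAt ξ := ξ.splittingAt.chart
  mem_chart_source ξ := by
    have hc := Splitting.scale_ne_zero hd.out hN.out
    change (_ : ℂ) ≠ 0
    rw [splittingAt_spec ξ, Matrix.mul_smul, Matrix.smul_mul, ← Matrix.mul_assoc,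
      ξ.splittingAt.hAA, Matrix.one_mul, ξ.splittingAt.hAA, Matrix.det_smul, Matrix.det_one, mul_one]
    exact pow_ne_zero _ hc
  chart_mem_atlas ξ := ⟨_, rfl⟩
end Orbit

/-! ### The Kirillov–Kostant–Souriau form -/

/-- The pairing `α_ξ(η) = (i / 2) tr (ηᴴ ξ)` of a Hermitian matrix `ξ` with a skew-Hermitian `η`
(a real number for such `ξ` and `η`), which identifies Hermitian matrices with `𝔲(N)*`. -/
def alphaPairing {N : ℕ} (ξ η : Matrix (Fin N) (Fin N) ℂ) : ℝ :=
  (Complex.I / 2 * (ηᴴ * ξ).trace).re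

namespace Orbit

variable {d N : ℕ}

/-- For `X` tangent to the orbit at `ξ`, this is a skew-Hermitian `η` with `⁅η, ξ⁆ = X`. -/
def lift (ξ : Orbit d N) (X : Matrix (Fin N) (Fin N) ℂ) : Matrix (Fin N) (Fin N) ℂ :=
  ((d : ℝ) / N) ^ 2 • ⁅X, ξ.incl⁆

theorem continuous_lift (ξ : Orbit d N) : Continuous ξ.lift := by
  unfold lift
  simp only [Ring.lie_def]
  exact ((continuous_id.matrix_mul continuous_const).sub
    (continuous_const.matrix_mul continuous_id)).const_smul (((d : ℝ) / N) ^ 2)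

theorem lift_add (ξ : Orbit d N) (X Y : Matrix (Fin N) (Fin N) ℂ) :
    ξ.lift (X + Y) = ξ.lift X + ξ.lift Y := by
  simp only [lift, Ring.lie_def, Matrix.add_mul, Matrix.mul_add, ← smul_add]
  congr 1
  abel

theorem lift_smul (ξ : Orbit d N) (c : ℝ) (X : Matrix (Fin N) (Fin N) ℂ) :
    ξ.lift (c • X) = c • ξ.lift X := by
  simp only [lift, Ring.lie_def, Matrix.smul_mul, Matrix.mul_smul, ← smul_sub]
  rw [smul_comm]

theorem alphaPairing_add (ξ η η' : Matrix (Fin N) (Fin N) ℂ) :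
    alphaPairing ξ (η + η') = alphaPairing ξ η + alphaPairing ξ η' := by
  simp only [alphaPairing, Matrix.conjTranspose_add, Matrix.add_mul, Matrix.trace_add, mul_add,
    Complex.add_re]

theorem alphaPairing_smul (ξ η : Matrix (Fin N) (Fin N) ℂ) (c : ℝ) :
    alphaPairing ξ (c • η) = c • alphaPairing ξ η := by
  simp only [alphaPairing, Matrix.conjTranspose_smul, Matrix.smul_mul, Matrix.trace_smul,
    star_trivial, mul_smul_comm, Complex.smul_re]

theorem smul_lie_matrix (X Y : Matrix (Fin N) (Fin N) ℂ) (c : ℝ) : ⁅c • X, Y⁆ = c • ⁅X, Y⁆ := by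
  simp only [Ring.lie_def, Matrix.smul_mul, Matrix.mul_smul, ← smul_sub]

theorem lie_smul_matrix (X Y : Matrix (Fin N) (Fin N) ℂ) (c : ℝ) : ⁅X, c • Y⁆ = c • ⁅X, Y⁆ := by
  simp only [Ring.lie_def, Matrix.smul_mul, Matrix.mul_smul, ← smul_sub]

/-- The alternating form `(X, Y) ↦ α_ξ(⁅η_X, η_Y⁆)`, where `η_X` is the lift of `X`. -/
def ambientKKS (ξ : Orbit d N) : Matrix (Fin N) (Fin N) ℂ [⋀^Fin 2]→L[ℝ] ℝ where
  toFun m := alphaPairing ξ.incl ⁅ξ.lift (m 0), ξ.lift (m 1)⁆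
  map_update_add' m i x y := by
    fin_cases i <;> simp [lift_add, ← alphaPairing_add, Ring.lie_def, Matrix.add_mul, Matrix.mul_add] <;>
      congr 1 <;> abel
  map_update_smul' m i c x := by
    fin_cases i <;>
      simp [lift_smul, smul_lie_matrix, lie_smul_matrix, alphaPairing_smul]
  cont := by
    have h0 : Continuous fun m : Fin 2 → Matrix (Fin N) (Fin N) ℂ => ξ.lift (m 0) :=
      ξ.continuous_lift.comp (continuous_apply 0)
    have h1 : Continuous fun m : Fin 2 → Matrix (Fin N) (Fin N) ℂ => ξ.lift (m 1) :=
      ξ.continuous_lift.comp (continuous_apply 1)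
    have hb : Continuous fun m : Fin 2 → Matrix (Fin N) (Fin N) ℂ =>
        ⁅ξ.lift (m 0), ξ.lift (m 1)⁆ := (h0.matrix_mul h1).sub (h1.matrix_mul h0)
    exact Complex.continuous_re.comp (continuous_const.mul
      (hb.matrix_conjTranspose.matrix_mul continuous_const).matrix_trace)
  map_eq_zero_of_eq' m i j h hij := by
    have h01 : m 0 = m 1 := by
      fin_cases i <;> fin_cases j <;> simp_all
    change alphaPairing ξ.incl ⁅ξ.lift (m 0), ξ.lift (m 1)⁆ = 0
    rw [h01, Ring.lie_def, sub_self]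
    simp [alphaPairing]

variable [Fact (0 < d)] [Fact (d ≤ N)]

/-- The differential of the inclusion, from the tangent space of the orbit into matrices. -/
def tangentIncl (ξ : Orbit d N) :
    TangentSpace 𝓘(ℝ, OrbitModel d N) ξ →L[ℝ] Matrix (Fin N) (Fin N) ℂ :=
  mfderiv 𝓘(ℝ, OrbitModel d N) 𝓘(ℝ, Matrix (Fin N) (Fin N) ℂ) incl ξ

/-- The Kirillov–Kostant–Souriau form: `ω_ξ(⁅η, ξ⁆, ⁅η', ξ⁆) = α_ξ(⁅η, η'⁆)`. -/
def kksForm (d N : ℕ) [Fact (0 < d)] [Fact (d ≤ N)] : TwoForm (OrbitModel d N) (Orbit d N) :=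
  fun ξ => ξ.ambientKKS.compContinuousLinearMap ξ.tangentIncl

end Orbit

/-! ### The torus action -/

namespace Orbit

variable {d N : ℕ} [hd : Fact (0 < d)] [hN : Fact (d ≤ N)]

/-- The action of `U(N)` on `𝒪_{N/d}` by conjugation. -/
instance : MulAction (Matrix.unitaryGroup (Fin N) ℂ) (Orbit d N) where
  smul U ξ := ⟨(U : Matrix (Fin N) (Fin N) ℂ) * ξ.incl * (U : Matrix (Fin N) (Fin N) ℂ)ᴴ, by
    have hU : (U : Matrix (Fin N) (Fin N) ℂ)ᴴ * U = 1 := Unitary.coe_star_mul_self U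
    obtain ⟨h, h2, ht⟩ := (isOrbitMatrix_iff hd.out hN.out _).1 ξ.2
    refine (isOrbitMatrix_iff hd.out hN.out _).2 ⟨?_, ?_, ?_⟩
    · have : (ξ.incl)ᴴ = ξ.incl := h
      simp [Matrix.IsHermitian, Matrix.conjTranspose_mul, this, Matrix.mul_assoc]
    · have h2' : ξ.incl * ξ.incl = ((N : ℂ) / d) • ξ.incl := h2
      generalize (U : Matrix (Fin N) (Fin N) ℂ) = V at *
      calc V * ξ.incl * Vᴴ * (V * ξ.incl * Vᴴ) = V * ξ.incl * (Vᴴ * V) * ξ.incl * Vᴴ := by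
            simp only [Matrix.mul_assoc]
        _ = V * (ξ.incl * ξ.incl) * Vᴴ := by rw [hU]; simp only [Matrix.mul_assoc, Matrix.one_mul]
        _ = _ := by rw [h2']; simp only [Matrix.mul_smul, Matrix.smul_mul]
    · rw [Matrix.trace_mul_comm, ← Matrix.mul_assoc, hU, Matrix.one_mul]
      exact ht⟩
  one_smul ξ := Subtype.ext (by
    change _ * ξ.incl * _ = ξ.incl
    simp)
  mul_smul U V ξ := Subtype.ext (by
    change _ * ξ.incl * _ = _ * (_ * ξ.incl * _) * _
    simp [Matrix.conjTranspose_mul, Matrix.mul_assoc])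

end Orbit

/-- The torus `U(1)^N` as the group of diagonal unitary matrices. -/
def torusToUnitary (N : ℕ) : (Fin N → Circle) →* Matrix.unitaryGroup (Fin N) ℂ where
  toFun g := ⟨Matrix.diagonal fun k => (g k : ℂ), by
    rw [Matrix.mem_unitaryGroup_iff, Matrix.star_eq_conjTranspose, Matrix.diagonal_conjTranspose,
      Matrix.diagonal_mul_diagonal, ← Matrix.diagonal_one]
    congr 1
    ext k
    simp [Complex.mul_conj, Circle.normSq_coe]⟩
  map_one' := Subtype.ext (by simp)
  map_mul' g h := Subtype.ext (by simp)

/-- The scalars `U(1)` inside `U(1)^N`. -/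
def scalarTorus (N : ℕ) : Subgroup (Fin N → Circle) :=
  (Pi.constMonoidHom (Fin N) Circle).range

/-- With `N = n + 1`, the torus `G = U(1)^N / U(1)`, identified with the elements of `U(1)^N` whose
last entry is `1`, that is, with `U(1)^n`. -/
abbrev EffTorus (n : ℕ) : Type := Fin n → Circle

/-- The inclusion of `G` into `U(1)^N`, which appends the entry `1`. -/
def EffTorus.incl (n : ℕ) : EffTorus n →* (Fin (n + 1) → Circle) where
  toFun g := Fin.snoc (α := fun _ => Circle) g 1
  map_one' := by
    ext k
    refine Fin.lastCases ?_ (fun i => ?_) k <;> simp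
  map_mul' g h := by
    ext k
    refine Fin.lastCases ?_ (fun i => ?_) k <;> simp

/-- `G` acts on `𝒪_{N/d}` by conjugation: `D • ξ = D ξ Dᴴ`. -/
instance {d n : ℕ} [Fact (0 < d)] [Fact (d ≤ n + 1)] : MulAction (EffTorus n) (Orbit d (n + 1)) :=
  MulAction.compHom _ ((torusToUnitary (n + 1)).comp (EffTorus.incl n))

/-- The coordinate `θ_k` on the Lie algebra of `G`: a tangent vector `v` at `1` changes the `k`-th
entry of `g` with velocity `i θ_k(v)`; so `v` is the matrix `diag(i θ_1, …, i θ_n, 0)`. -/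
def EffTorus.angle {n : ℕ} (k : Fin n) :
    GroupLieAlgebra (torusModel (Fin n)) (EffTorus n) →L[ℝ] ℝ :=
  Complex.imCLM.comp
    (mfderiv (torusModel (Fin n)) 𝓘(ℝ, ℂ) (fun g : EffTorus n => (g k : ℂ)) 1)

/-- The identification `ℝ^n ≈ 𝔤*`, under which `x` is the functional `v ↦ ½ ∑ x_k θ_k(v)`. -/
def EffTorus.dualOfCoords (n : ℕ) (x : Fin n → ℝ) :
    GroupLieAlgebra (torusModel (Fin n)) (EffTorus n) →L[ℝ] ℝ :=
  (1 / 2 : ℝ) • ∑ k, x k • EffTorus.angle k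

/-- The map `Φ_G`: the first `n = N - 1` diagonal entries of a matrix in the orbit. -/
def Orbit.momentum {d n : ℕ} (ξ : Orbit d (n + 1)) (k : Fin n) : ℝ :=
  (ξ.incl k.castSucc k.castSucc).re

/-! ### Tight frames -/

/-- The space of `N / d`-tight frames of `N` vectors in `ℂ^d` (the columns of a matrix). -/
def TightFrame (d N : ℕ) : Type :=
  {F : Matrix (Fin d) (Fin N) ℂ // F * Fᴴ = ((N : ℂ) / d) • (1 : Matrix (Fin d) (Fin d) ℂ)}

namespace TightFrame

variable {d N : ℕ}

/-- The matrix of a frame. -/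
def mat (F : TightFrame d N) : Matrix (Fin d) (Fin N) ℂ := F.1

instance : TopologicalSpace (TightFrame d N) := instTopologicalSpaceSubtype

theorem mat_mul (F : TightFrame d N) :
    F.mat * F.matᴴ = ((N : ℂ) / d) • (1 : Matrix (Fin d) (Fin d) ℂ) := F.2

/-- The action of `U(d)` by left multiplication. -/
instance : MulAction (Matrix.unitaryGroup (Fin d) ℂ) (TightFrame d N) where
  smul A F := ⟨(A : Matrix (Fin d) (Fin d) ℂ) * F.mat, by
    have hA : (A : Matrix (Fin d) (Fin d) ℂ) * (A : Matrix (Fin d) (Fin d) ℂ)ᴴ = 1 :=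
      Unitary.coe_mul_star_self A
    rw [Matrix.conjTranspose_mul, Matrix.mul_assoc, ← Matrix.mul_assoc F.mat, F.mat_mul,
      Matrix.smul_mul, Matrix.one_mul, Matrix.mul_smul, hA]⟩
  one_smul F := Subtype.ext (by
    change _ * F.mat = F.mat
    simp)
  mul_smul A B F := Subtype.ext (by
    change _ * F.mat = _ * (_ * F.mat)
    simp [Matrix.mul_assoc])

/-- The action of `U(1)^N` by `D · F = F Dᴴ`. -/
def torusAct (g : Fin N → Circle) (F : TightFrame d N) : TightFrame d N :=
  ⟨F.mat * (torusToUnitary N g : Matrix (Fin N) (Fin N) ℂ)ᴴ, by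
    have hD : (torusToUnitary N g : Matrix (Fin N) (Fin N) ℂ)ᴴ * torusToUnitary N g = 1 :=
      Unitary.coe_star_mul_self _
    rw [Matrix.conjTranspose_mul, Matrix.conjTranspose_conjTranspose, Matrix.mul_assoc,
      ← Matrix.mul_assoc _ _ F.matᴴ, hD, Matrix.one_mul, F.mat_mul]⟩

/-- `X` is tangent at `F` to the level set `{F | F Fᴴ = N / d}`. -/
def IsTangent (F : TightFrame d N) (X : Matrix (Fin d) (Fin N) ℂ) : Prop :=
  X * F.matᴴ + F.mat * Xᴴ = 0

/-- The Gram matrix `Fᴴ F`, an element of `𝒪_{N/d}`. -/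
def gram [hd : Fact (0 < d)] [hN : Fact (d ≤ N)] (F : TightFrame d N) : Orbit d N :=
  ⟨F.matᴴ * F.mat, by
    have hd' : (d : ℂ) ≠ 0 := by exact_mod_cast hd.out.ne'
    refine (isOrbitMatrix_iff hd.out hN.out _).2 ⟨?_, ?_, ?_⟩
    · simp [Matrix.IsHermitian]
    · rw [Matrix.mul_assoc, ← Matrix.mul_assoc F.mat, F.mat_mul]
      simp
    · rw [Matrix.trace_mul_comm, F.mat_mul, Matrix.trace_smul, Matrix.trace_one]
      simp
      field_simp⟩

variable (d N) in
/-- The space of unitary equivalence classes of `N / d`-tight frames. -/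
abbrev Classes : Type := MulAction.orbitRel.Quotient (Matrix.unitaryGroup (Fin d) ℂ) (TightFrame d N)

/-- The map `[F] ↦ Fᴴ F`. -/
def gramClass [Fact (0 < d)] [Fact (d ≤ N)] : Classes d N → Orbit d N :=
  Quotient.lift gram (by
    rintro _ F ⟨A, rfl⟩
    have hA : (A : Matrix (Fin d) (Fin d) ℂ)ᴴ * A = 1 := Unitary.coe_star_mul_self A
    refine Subtype.ext ?_
    change ((A : Matrix (Fin d) (Fin d) ℂ) * F.mat)ᴴ *
      ((A : Matrix (Fin d) (Fin d) ℂ) * F.mat) = F.matᴴ * F.mat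
    rw [Matrix.conjTranspose_mul, Matrix.mul_assoc, ← Matrix.mul_assoc _ _ F.mat, hA,
      Matrix.one_mul])

end TightFrame

/-- `𝒪_{N/d}` is a smooth manifold, embedded in the space of matrices, with tangent space
`{⁅η, ξ⁆ | η ∈ 𝔲(N)}` at `ξ`, a single orbit of `U(N)`, and its form is characterized by the
Kirillov–Kostant–Souriau formula. -/
structure IsCoadjointOrbit (d N : ℕ) [Fact (0 < d)] [Fact (d ≤ N)] : Prop where
  isManifold : IsManifold 𝓘(ℝ, OrbitModel d N) ∞ (Orbit d N)
  smooth_incl : ContMDiff 𝓘(ℝ, OrbitModel d N) 𝓘(ℝ, Matrix (Fin N) (Fin N) ℂ) ∞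
    (Orbit.incl : Orbit d N → Matrix (Fin N) (Fin N) ℂ)
  injective : ∀ ξ : Orbit d N, Function.Injective ξ.tangentIncl
  range_eq : ∀ ξ : Orbit d N, Set.range ξ.tangentIncl =
    {X | ∃ η : Matrix (Fin N) (Fin N) ℂ, ηᴴ = -η ∧ X = ⁅η, ξ.incl⁆}
  nonempty : Nonempty (Orbit d N)
  transitive : MulAction.IsPretransitive (Matrix.unitaryGroup (Fin N) ℂ) (Orbit d N)
  kks : ∀ (ξ : Orbit d N) (v w : TangentSpace 𝓘(ℝ, OrbitModel d N) ξ)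
    (η η' : Matrix (Fin N) (Fin N) ℂ), ηᴴ = -η → η'ᴴ = -η' →
    ξ.tangentIncl v = ⁅η, ξ.incl⁆ → ξ.tangentIncl w = ⁅η', ξ.incl⁆ →
    Orbit.kksForm d N ξ ![v, w] = alphaPairing ξ.incl ⁅η, η'⁆

/-- `[F] ↦ Fᴴ F` identifies the symplectic quotient of `N / d`-tight frames by `U(d)` with
`𝒪_{N/d}`, compatibly with the actions of `U(1)^N`. -/
structure GramIsSymplectomorphism (d N : ℕ) [Fact (0 < d)] [Fact (d ≤ N)] : Prop where
  isHomeomorph : IsHomeomorph (TightFrame.gramClass (d := d) (N := N))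
  equivariant : ∀ (g : Fin N → Circle) (F : TightFrame d N),
    (F.torusAct g).gram = torusToUnitary N g • F.gram
  /-- the differential of `F ↦ Fᴴ F` is onto the tangent space of the orbit -/
  range_eq : ∀ F : TightFrame d N, Set.range F.gram.tangentIncl =
    {T | ∃ X, F.IsTangent X ∧ T = Xᴴ * F.mat + F.matᴴ * X}
  /-- and its kernel is the tangent space of the `U(d)`-orbit of `F` -/
  ker_eq : ∀ (F : TightFrame d N) (X : Matrix (Fin d) (Fin N) ℂ), F.IsTangent X →
    (Xᴴ * F.mat + F.matᴴ * X = 0 ↔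
      ∃ η : Matrix (Fin d) (Fin d) ℂ, ηᴴ = -η ∧ X = η * F.mat)
  /-- the form on the orbit pulls back to the restriction of the standard symplectic form
  `(X, Y) ↦ -Im tr (Yᴴ X)` to tight frames -/
  pullback : ∀ (F : TightFrame d N) (X Y : Matrix (Fin d) (Fin N) ℂ),
    F.IsTangent X → F.IsTangent Y → ∀ v w : TangentSpace 𝓘(ℝ, OrbitModel d N) F.gram,
    F.gram.tangentIncl v = Xᴴ * F.mat + F.matᴴ * X →
    F.gram.tangentIncl w = Yᴴ * F.mat + F.matᴴ * Y →
    Orbit.kksForm d N F.gram ![v, w] = -((Yᴴ * X).trace).im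

end

/-! Put c = N/d. A point of the orbit is c times an orthogonal projection of rank d, that is, a
Hermitian ξ with ξ² = cξ and trace N, so everything reduces to matrix algebra with explicit charts.

Manifold. In a graph chart the inclusion is Z ↦ c W K⁻¹ Wᴴ with W = A + BZ and K = WᴴW = 1 + ZᴴZ.
This map and the coordinate ξ ↦ Z are both given by smooth matrix formulas in the ambient spaces,
hence the atlas is smooth and maps into the orbit can be tested in the space of matrices. The
derivative in direction U is c(S + Sᴴ), where S (`slope`) maps the range of ξ to its orthogonal
complement. Since Sξ = cS and ξS = 0, it equals ⁅S - Sᴴ, ξ⁆; this links coordinates with Lie algebra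
generators.

Form. Cyclicity of the trace gives α_ξ(⁅η, η'⁆) = Re(-(i/2) tr(η ⁅η', ξ⁆)) (`alphaPairing_lie`), so
the value depends only on the tangent vectors. In every graph chart the form becomes -c Im tr(S_Uᴴ
S_V), which is the exterior derivative of V ↦ -(c/2) Im tr(K⁻¹ Zᴴ V); this primitive is -(c/2) Im ∂
log det(1 + ZᴴZ), from the Fubini–Study potential (`kksForm_inChart`). Smoothness and closedness
follow. At the centre of the chart the form is -c Im tr(UᴴV), which is nondegenerate.

Frames. The Gram map induces a continuous bijection from a compact space to a Hausdorff one. A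
tangent vector X at F has image ⁅c⁻¹(XᴴF - FᴴX), FᴴF⁆, and inserting these generators into α yields
-Im tr(YᴴX).

Momentum map. The field of v is ⁅diag(iθ_1, …, iθ_n, 0), ξ⁆, so the formula for α gives ω(X^v, Y) =
½ ∑ θ_k Re Y_kk. This is the differential of the linear function ξ ↦ ½ ∑ θ_k ξ_kk. Invariance of ω
holds under all of U(N), and equivariance says that conjugation by a diagonal unitary fixes the
diagonal, since G is abelian. -/

noncomputable section

/-! ### Calculus with matrix-valued functions -/

section MatrixCalculus

variable {l m k : Type*}

/-- The entry at `(i, j)` as a continuous `ℝ`-linear map. -/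
def entryCLM (i : l) (j : m) : Matrix l m ℂ →L[ℝ] ℂ where
  toFun A := A i j
  map_add' _ _ := rfl
  map_smul' _ _ := rfl
  cont := continuous_id.matrix_elem i j

theorem entryCLM_apply (i : l) (j : m) (A : Matrix l m ℂ) : entryCLM i j A = A i j := rfl

variable [Fintype l] [Fintype m] [Fintype k] [DecidableEq m] [DecidableEq k]

/-- The L² operator norm is submultiplicative for rectangular matrices too. Smoothness and product
rules for matrix-valued maps come from here. -/
theorem isBoundedBilinearMap_matrix_mul :
    IsBoundedBilinearMap ℝ (fun p : Matrix l m ℂ × Matrix m k ℂ => p.1 * p.2) where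
  add_left _ _ _ := Matrix.add_mul _ _ _
  smul_left _ _ _ := Matrix.smul_mul _ _ _
  add_right _ _ _ := Matrix.mul_add _ _ _
  smul_right _ _ _ := Matrix.mul_smul _ _ _
  bound := ⟨1, one_pos, fun A B => by simpa using Matrix.l2_opNorm_mul A B⟩

variable (l m) in
/-- The conjugate transpose as a continuous `ℝ`-linear map. -/
def conjTransposeCLM [DecidableEq l] : Matrix l m ℂ →L[ℝ] Matrix m l ℂ where
  toFun A := Aᴴ
  map_add' := Matrix.conjTranspose_add
  map_smul' c A := by simp [Matrix.conjTranspose_smul]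
  cont := continuous_id.matrix_conjTranspose

variable (l) in
/-- The trace as a continuous `ℝ`-linear map. -/
def traceCLM [DecidableEq l] : Matrix l l ℂ →L[ℝ] ℂ where
  toFun A := A.trace
  map_add' := Matrix.trace_add
  map_smul' c A := Matrix.trace_smul c A
  cont := continuous_id.matrix_trace

/-- `diagonal` as a continuous `ℝ`-linear map. -/
def diagonalCLM (l : Type*) [Fintype l] [DecidableEq l] : (l → ℂ) →L[ℝ] Matrix l l ℂ where
  toFun v := Matrix.diagonal v
  map_add' v w := (Matrix.diagonal_add v w).symm
  map_smul' c v := Matrix.diagonal_smul c v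
  cont := continuous_id.matrix_diagonal

section ContDiff

variable {E : Type*} [NormedAddCommGroup E] [NormedSpace ℝ E] {s : Set E}

theorem ContDiffOn.matrix_mul {f : E → Matrix l m ℂ} {g : E → Matrix m k ℂ}
    (hf : ContDiffOn ℝ ∞ f s) (hg : ContDiffOn ℝ ∞ g s) :
    ContDiffOn ℝ ∞ (fun x => f x * g x) s :=
  isBoundedBilinearMap_matrix_mul.contDiff.comp_contDiffOn (hf.prodMk hg)

theorem ContDiffOn.matrix_conjTranspose [DecidableEq l] {f : E → Matrix l m ℂ} (hf : ContDiffOn ℝ ∞ f s) :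
    ContDiffOn ℝ ∞ (fun x => (f x)ᴴ) s :=
  (conjTransposeCLM l m).contDiff.comp_contDiffOn hf

/-- Square matrices form a complete normed ring, where inversion is smooth at every unit. -/
theorem ContDiffOn.matrix_inv [DecidableEq l] {f : E → Matrix l l ℂ} (hf : ContDiffOn ℝ ∞ f s)
    (hu : ∀ x ∈ s, IsUnit (f x).det) : ContDiffOn ℝ ∞ (fun x => (f x)⁻¹) s := by
  intro x hx
  obtain ⟨u, hu⟩ := (Matrix.isUnit_iff_isUnit_det _).2 (hu x hx)
  have h := contDiffAt_ringInverse ℝ (n := ∞) u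
  rw [hu] at h
  simp only [Matrix.nonsing_inv_eq_ringInverse]
  exact h.comp_contDiffWithinAt x (hf x hx)

end ContDiff

section Deriv

theorem HasDerivAt.matrix_mul {f : ℝ → Matrix l m ℂ} {g : ℝ → Matrix m k ℂ} {f' : Matrix l m ℂ}
    {g' : Matrix m k ℂ} {t : ℝ} (hf : HasDerivAt f f' t) (hg : HasDerivAt g g' t) :
    HasDerivAt (fun x => f x * g x) (f' * g t + f t * g') t := by
  have h := (isBoundedBilinearMap_matrix_mul.hasFDerivAt (f t, g t)).comp_hasDerivAt t
    (hf.prodMk hg)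
  refine h.congr_deriv ?_
  simp [IsBoundedBilinearMap.deriv, add_comm]

theorem HasDerivAt.matrix_conjTranspose [DecidableEq l] {f : ℝ → Matrix l m ℂ} {f' : Matrix l m ℂ} {t : ℝ}
    (hf : HasDerivAt f f' t) : HasDerivAt (fun x => (f x)ᴴ) f'ᴴ t :=
  (conjTransposeCLM l m).hasFDerivAt.comp_hasDerivAt t hf

theorem HasDerivAt.matrix_inv [DecidableEq l] {f : ℝ → Matrix l l ℂ} {f' : Matrix l l ℂ} {t : ℝ}
    (hf : HasDerivAt f f' t) (hu : IsUnit (f t).det) :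
    HasDerivAt (fun x => (f x)⁻¹) (-((f t)⁻¹ * f' * (f t)⁻¹)) t := by
  obtain ⟨u, hu⟩ := (Matrix.isUnit_iff_isUnit_det _).2 hu
  have h := hasFDerivAt_ringInverse (𝕜 := ℝ) u
  rw [hu] at h
  simp only [Matrix.nonsing_inv_eq_ringInverse]
  refine (h.comp_hasDerivAt t hf).congr_deriv ?_
  rw [← hu, Ring.inverse_unit]
  simp

end Deriv

end MatrixCalculus

/-! ### The graph charts -/

namespace Splitting

variable {d N : ℕ}

theorem contDiff_graphFrame (s : Splitting d N) : ContDiff ℝ ∞ s.graphFrame := by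
  rw [← contDiffOn_univ]
  exact contDiffOn_const.add (contDiffOn_const.matrix_mul contDiffOn_id)

theorem contDiff_inv_gram :
    ContDiff ℝ ∞ (fun Z : Matrix (Fin (N - d)) (Fin d) ℂ => (1 + Zᴴ * Z)⁻¹) := by
  rw [← contDiffOn_univ]
  exact (contDiffOn_const.add (contDiffOn_id.matrix_conjTranspose.matrix_mul
    contDiffOn_id)).matrix_inv fun Z _ => isUnit_gram Z

theorem contDiff_graphMatrix (s : Splitting d N) : ContDiff ℝ ∞ s.graphMatrix := by
  have hW := s.contDiff_graphFrame.contDiffOn (s := Set.univ)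
  have hK := (contDiff_inv_gram (d := d) (N := N)).contDiffOn (s := Set.univ)
  rw [← contDiffOn_univ]
  exact ((hW.matrix_mul hK).matrix_mul hW.matrix_conjTranspose).const_smul ((N : ℂ) / d)

theorem isOpen_coord_domain (s : Splitting d N) :
    IsOpen {ξ : Matrix (Fin N) (Fin N) ℂ | (s.Aᴴ * ξ * s.A).det ≠ 0} :=
  isOpen_ne_fun (((continuous_const.matrix_mul continuous_id).matrix_mul
    continuous_const).matrix_det) continuous_const

theorem contDiffOn_coord (s : Splitting d N) :
    ContDiffOn ℝ ∞ s.coord {ξ : Matrix (Fin N) (Fin N) ℂ | (s.Aᴴ * ξ * s.A).det ≠ 0} :=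
  ((contDiffOn_const.matrix_mul contDiffOn_id).matrix_mul contDiffOn_const).matrix_mul
    (((contDiffOn_const.matrix_mul contDiffOn_id).matrix_mul contDiffOn_const).matrix_inv
      fun _ hξ => IsUnit.mk0 _ hξ)

/-- The component of the velocity of the graph projection that maps the graph of `Z` to its
orthogonal complement, when `Z` moves with velocity `U`. -/
def slope (s : Splitting d N) (Z U : Matrix (Fin (N - d)) (Fin d) ℂ) :
    Matrix (Fin N) (Fin N) ℂ :=
  (1 - s.graphFrame Z * (1 + Zᴴ * Z)⁻¹ * (s.graphFrame Z)ᴴ) * (s.B * U) * (1 + Zᴴ * Z)⁻¹ *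
    (s.graphFrame Z)ᴴ

theorem conjTranspose_inv_gram (Z : Matrix (Fin (N - d)) (Fin d) ℂ) :
    ((1 + Zᴴ * Z)⁻¹)ᴴ = (1 + Zᴴ * Z)⁻¹ := by
  rw [Matrix.conjTranspose_nonsing_inv]; simp

theorem fderiv_graphMatrix (s : Splitting d N) (Z U : Matrix (Fin (N - d)) (Fin d) ℂ) :
    fderiv ℝ s.graphMatrix Z U = ((N : ℂ) / d) • (s.slope Z U + (s.slope Z U)ᴴ) := by
  have hZ : HasDerivAt (fun t : ℝ => Z + t • U) U 0 := by
    simpa using ((hasDerivAt_id (0 : ℝ)).smul_const U).const_add Z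
  have hW : HasDerivAt (fun t : ℝ => s.graphFrame (Z + t • U)) (s.B * U) 0 := by
    refine (((hasDerivAt_const (0 : ℝ) s.B).matrix_mul hZ).const_add s.A).congr_deriv ?_
    simp
  -- Write 1 + ZᴴZ as WᴴW, so that only W and its velocity BU enter the derivative.
  have hK := hW.matrix_conjTranspose.matrix_mul hW
  have hu : IsUnit ((s.graphFrame (Z + (0 : ℝ) • U))ᴴ * s.graphFrame (Z + (0 : ℝ) • U)).det := by
    rw [graphFrame_gram]; exact isUnit_gram _
  have h := ((hW.matrix_mul (hK.matrix_inv hu)).matrix_mul hW.matrix_conjTranspose).const_smul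
    ((N : ℂ) / d)
  have hf := ((s.contDiff_graphMatrix.differentiable (by simp)).differentiableAt (x := Z)
    ).hasFDerivAt.hasLineDerivAt U
  refine hf.unique (h.congr_deriv ?_ |>.congr_of_eventuallyEq ?_)
  · simp only [zero_smul, add_zero, graphFrame_gram, slope]
    congr 1
    generalize s.graphFrame Z = W
    have hK := conjTranspose_inv_gram Z
    generalize (1 + Zᴴ * Z)⁻¹ = K at *
    generalize s.B * U = V
    simp only [Matrix.conjTranspose_mul, Matrix.conjTranspose_sub, hK,
      Matrix.conjTranspose_conjTranspose, Matrix.sub_mul, Matrix.add_mul,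
      Matrix.mul_add, Matrix.one_mul, Matrix.mul_neg, Matrix.neg_mul,
      Matrix.mul_assoc]
    abel
  · filter_upwards with t
    simp only [graphMatrix, graphFrame_gram]
    rfl

/-- `slope` ends in Wᴴ, and Wᴴ(W K⁻¹ Wᴴ) = Wᴴ because WᴴW = K. -/
theorem slope_mul_graphMatrix (s : Splitting d N) (Z U : Matrix (Fin (N - d)) (Fin d) ℂ) :
    s.slope Z U * s.graphMatrix Z = ((N : ℂ) / d) • s.slope Z U := by
  have hg := s.graphFrame_gram Z
  have hu := isUnit_gram Z
  rw [slope, graphMatrix, Matrix.mul_smul]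
  congr 1
  generalize s.graphFrame Z = W at *
  generalize 1 + Zᴴ * Z = K at *
  generalize (1 - W * K⁻¹ * Wᴴ) * (s.B * U) = V
  calc V * K⁻¹ * Wᴴ * (W * K⁻¹ * Wᴴ) = V * K⁻¹ * ((Wᴴ * W) * K⁻¹) * Wᴴ := by
        simp only [Matrix.mul_assoc]
    _ = _ := by rw [hg, Matrix.mul_nonsing_inv _ hu, Matrix.mul_one]

/-- `slope` begins with the projection 1 - W K⁻¹ Wᴴ onto the complement of the graph. -/
theorem graphMatrix_mul_slope (s : Splitting d N) (Z U : Matrix (Fin (N - d)) (Fin d) ℂ) :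
    s.graphMatrix Z * s.slope Z U = 0 := by
  have hg := s.graphFrame_gram Z
  have hu := isUnit_gram Z
  rw [slope, graphMatrix, Matrix.smul_mul]
  generalize s.graphFrame Z = W at *
  generalize 1 + Zᴴ * Z = K at *
  have : W * K⁻¹ * Wᴴ * (1 - W * K⁻¹ * Wᴴ) = 0 := by
    rw [Matrix.mul_sub, Matrix.mul_one, sub_eq_zero]
    calc W * K⁻¹ * Wᴴ = W * K⁻¹ * ((Wᴴ * W) * K⁻¹) * Wᴴ := by
          rw [hg, Matrix.mul_nonsing_inv _ hu, Matrix.mul_one]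
      _ = _ := by simp only [Matrix.mul_assoc]
  simp only [← Matrix.mul_assoc]
  simp [this]

theorem isHermitian_graphMatrix (s : Splitting d N) (Z : Matrix (Fin (N - d)) (Fin d) ℂ) :
    (s.graphMatrix Z)ᴴ = s.graphMatrix Z := by
  rw [graphMatrix, Matrix.conjTranspose_smul]
  simp [Matrix.conjTranspose_mul, conjTranspose_inv_gram, Matrix.mul_assoc]

theorem graphMatrix_mul_conjTranspose_slope (s : Splitting d N)
    (Z U : Matrix (Fin (N - d)) (Fin d) ℂ) :
    s.graphMatrix Z * (s.slope Z U)ᴴ = ((N : ℂ) / d) • (s.slope Z U)ᴴ := by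
  have h := congrArg Matrix.conjTranspose (s.slope_mul_graphMatrix Z U)
  rw [Matrix.conjTranspose_mul, isHermitian_graphMatrix, Matrix.conjTranspose_smul] at h
  simpa using h

theorem conjTranspose_slope_mul_graphMatrix (s : Splitting d N)
    (Z U : Matrix (Fin (N - d)) (Fin d) ℂ) :
    (s.slope Z U)ᴴ * s.graphMatrix Z = 0 := by
  have h := congrArg Matrix.conjTranspose (s.graphMatrix_mul_slope Z U)
  rw [Matrix.conjTranspose_mul, isHermitian_graphMatrix] at h
  simpa using h

/-- The velocity of the graph projection is generated by the skew-Hermitian matrix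
`slope - slopeᴴ`. -/
theorem fderiv_graphMatrix_eq_lie (s : Splitting d N) (Z U : Matrix (Fin (N - d)) (Fin d) ℂ) :
    fderiv ℝ s.graphMatrix Z U = ⁅s.slope Z U - (s.slope Z U)ᴴ, s.graphMatrix Z⁆ := by
  rw [fderiv_graphMatrix, Ring.lie_def, Matrix.sub_mul, Matrix.mul_sub, slope_mul_graphMatrix,
    graphMatrix_mul_slope, graphMatrix_mul_conjTranspose_slope, conjTranspose_slope_mul_graphMatrix,
    smul_add]
  abel

/-- Insert ξ between the factors: ξ acts as c on the left one and kills the right one. -/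
theorem slope_mul_slope (hd : 0 < d) (hN : d ≤ N) (s : Splitting d N)
    (Z U V : Matrix (Fin (N - d)) (Fin d) ℂ) : s.slope Z U * s.slope Z V = 0 := by
  have h : ((N : ℂ) / d) • (s.slope Z U * s.slope Z V) = 0 := by
    rw [← Matrix.smul_mul, ← slope_mul_graphMatrix, Matrix.mul_assoc, graphMatrix_mul_slope,
      Matrix.mul_zero]
  exact (smul_eq_zero.1 h).resolve_left (scale_ne_zero hd hN)

/-- Cyclicity brings the two outer frames together, where WᴴW cancels one K⁻¹. The projection R = 1
- W K⁻¹ Wᴴ satisfies RᴴR = R, and its block BᴴRB is 1 - Z K⁻¹ Zᴴ. -/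
theorem trace_slope (s : Splitting d N) (Z U V : Matrix (Fin (N - d)) (Fin d) ℂ) :
    ((s.slope Z U)ᴴ * s.slope Z V).trace = ((1 + Zᴴ * Z)⁻¹ * Uᴴ * V).trace -
      ((1 + Zᴴ * Z)⁻¹ * Uᴴ * Z * (1 + Zᴴ * Z)⁻¹ * Zᴴ * V).trace := by
  have hg := s.graphFrame_gram Z
  have hu := isUnit_gram Z
  have hB := s.B_graphFrame Z
  have hB' : (s.graphFrame Z)ᴴ * s.B = Zᴴ := by
    simpa using congrArg Matrix.conjTranspose hB
  have hK := conjTranspose_inv_gram Z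
  have hBB := s.hBB
  rw [slope, slope]
  generalize s.graphFrame Z = W at *
  generalize s.B = B at *
  generalize 1 + Zᴴ * Z = K at *
  have hPP : W * K⁻¹ * Wᴴ * (W * K⁻¹ * Wᴴ) = W * K⁻¹ * Wᴴ := by
    calc W * K⁻¹ * Wᴴ * (W * K⁻¹ * Wᴴ) = W * K⁻¹ * ((Wᴴ * W) * K⁻¹) * Wᴴ := by
          simp only [Matrix.mul_assoc]
      _ = _ := by rw [hg, Matrix.mul_nonsing_inv _ hu, Matrix.mul_one]
  have hP : (1 - W * K⁻¹ * Wᴴ)ᴴ * (1 - W * K⁻¹ * Wᴴ) = 1 - W * K⁻¹ * Wᴴ := by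
    have : (W * K⁻¹ * Wᴴ)ᴴ = W * K⁻¹ * Wᴴ := by
      simp [Matrix.conjTranspose_mul, hK, Matrix.mul_assoc]
    rw [Matrix.conjTranspose_sub, this, Matrix.conjTranspose_one, Matrix.sub_mul,
      Matrix.mul_sub (W * K⁻¹ * Wᴴ), hPP]
    simp
  have hBPB : Bᴴ * (1 - W * K⁻¹ * Wᴴ) * B = 1 - Z * K⁻¹ * Zᴴ := by
    rw [Matrix.mul_sub, Matrix.sub_mul, Matrix.mul_one, hBB]
    congr 1
    calc _ = (Bᴴ * W) * K⁻¹ * (Wᴴ * B) := by simp only [Matrix.mul_assoc]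
      _ = _ := by rw [hB, hB']
  generalize 1 - W * K⁻¹ * Wᴴ = R at *
  rw [Matrix.trace_mul_comm, ← Matrix.trace_sub]
  calc (R * (B * V) * K⁻¹ * Wᴴ * (R * (B * U) * K⁻¹ * Wᴴ)ᴴ).trace
      = (R * (B * V) * (K⁻¹ * (Wᴴ * W)) * K⁻¹ * (B * U)ᴴ * Rᴴ).trace := by
        simp only [Matrix.conjTranspose_mul, hK, Matrix.conjTranspose_conjTranspose,
          Matrix.mul_assoc]
    _ = (R * (B * V) * (K⁻¹ * (B * U)ᴴ * Rᴴ)).trace := by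
        rw [hg, Matrix.nonsing_inv_mul _ hu]; simp only [Matrix.mul_assoc, Matrix.one_mul]
    _ = (K⁻¹ * Uᴴ * (Bᴴ * (Rᴴ * R) * B) * V).trace := by
        rw [Matrix.trace_mul_comm]
        simp only [Matrix.conjTranspose_mul, Matrix.mul_assoc]
    _ = _ := by
        rw [hP, hBPB]
        simp only [Matrix.mul_sub, Matrix.sub_mul, Matrix.mul_one, Matrix.mul_assoc]

end Splitting

/-! ### The orbit as an embedded submanifold -/

namespace Orbit

variable {d N : ℕ} [hN : Fact (d ≤ N)]

theorem coord_splittingAt (ξ : Orbit d N) : ξ.splittingAt.coord ξ.incl = 0 := by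
  rw [Splitting.coord, ξ.splittingAt_spec, Matrix.mul_smul, ← Matrix.mul_assoc, Splitting.hBA]
  simp

theorem graphMatrix_splittingAt_zero (ξ : Orbit d N) : ξ.splittingAt.graphMatrix 0 = ξ.incl := by
  rw [ξ.splittingAt_spec, Splitting.graphMatrix, Splitting.graphFrame]
  simp

variable [hd : Fact (0 < d)]

/-- Transition maps are `coord` of one splitting after `graphMatrix` of another, both smooth as maps
between matrix spaces. -/
instance : IsManifold 𝓘(ℝ, OrbitModel d N) ∞ (Orbit d N) := by
  apply isManifold_of_contDiffOn
  rintro e e' ⟨s, rfl⟩ ⟨s', rfl⟩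
  simp only [modelWithCornersSelf_coe, modelWithCornersSelf_coe_symm, Function.id_comp,
    Function.comp_id, Set.preimage_id, Set.range_id, Set.inter_univ]
  refine s'.contDiffOn_coord.comp s.contDiff_graphMatrix.contDiffOn ?_
  rintro Z ⟨-, hZ⟩
  exact hZ

theorem contMDiff_incl : ContMDiff 𝓘(ℝ, OrbitModel d N) 𝓘(ℝ, Matrix (Fin N) (Fin N) ℂ) ∞
    (incl : Orbit d N → Matrix (Fin N) (Fin N) ℂ) := by
  rw [contMDiff_iff]
  refine ⟨continuous_incl, fun ξ _ => ?_⟩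
  exact ξ.splittingAt.contDiff_graphMatrix.contDiffOn

theorem mdifferentiableAt_incl (ξ : Orbit d N) : MDifferentiableAt 𝓘(ℝ, OrbitModel d N)
    𝓘(ℝ, Matrix (Fin N) (Fin N) ℂ) (incl : Orbit d N → Matrix (Fin N) (Fin N) ℂ) ξ :=
  (contMDiff_incl ξ).mdifferentiableAt (by simp)

/-- A map into the orbit is smooth if it is smooth as a map into the space of matrices. -/
theorem contMDiff_of_incl_comp {E H M : Type*} [NormedAddCommGroup E] [NormedSpace ℝ E]
    [TopologicalSpace H] {I : ModelWithCorners ℝ E H} [TopologicalSpace M] [ChartedSpace H M]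
    {f : M → Orbit d N}
    (hf : ContMDiff I 𝓘(ℝ, Matrix (Fin N) (Fin N) ℂ) ∞ (fun x => (f x).incl)) :
    ContMDiff I 𝓘(ℝ, OrbitModel d N) ∞ f := by
  have hc : Continuous f := Topology.IsInducing.subtypeVal.continuous_iff.2 hf.continuous
  intro x
  rw [contMDiffAt_iff_target]
  refine ⟨hc.continuousAt, ?_⟩
  -- The coordinate is smooth on an open set of matrices, not only on the orbit, so it can be
  -- composed with the ambient map.
  have h := (f x).splittingAt.contDiffOn_coord.contDiffAt
    ((f x).splittingAt.isOpen_coord_domain.mem_nhds (mem_chart_source (OrbitModel d N) (f x)))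
  exact ContMDiffAt.comp (f := fun x => (f x).incl) x h.contMDiffAt (hf x)

/-- The preferred chart at ξ is centred: ξ has coordinate 0, so the manifold derivative is an
ordinary derivative at 0. -/
theorem tangentIncl_eq (ξ : Orbit d N) (U : OrbitModel d N) :
    ξ.tangentIncl U = fderiv ℝ ξ.splittingAt.graphMatrix 0 U := by
  have h : ξ.tangentIncl = fderivWithin ℝ ξ.splittingAt.graphMatrix
      (Set.range 𝓘(ℝ, OrbitModel d N)) (ξ.splittingAt.coord ξ.incl) :=
    (mdifferentiableAt_incl ξ).mfderiv
  rw [coord_splittingAt, modelWithCornersSelf_coe, Set.range_id, fderivWithin_univ] at h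
  exact DFunLike.congr_fun h U

theorem tangentIncl_eq_smul (ξ : Orbit d N) (U : OrbitModel d N) :
    ξ.tangentIncl U = ((N : ℂ) / d) • (ξ.splittingAt.B * U * ξ.splittingAt.Aᴴ +
      ξ.splittingAt.A * Uᴴ * ξ.splittingAt.Bᴴ) := by
  have h : ξ.splittingAt.slope 0 U = ξ.splittingAt.B * U * ξ.splittingAt.Aᴴ := by
    have : (1 : Matrix (Fin N) (Fin N) ℂ) - ξ.splittingAt.A * ξ.splittingAt.Aᴴ =
        ξ.splittingAt.B * ξ.splittingAt.Bᴴ := by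
      rw [← ξ.splittingAt.hsum]; abel
    simp only [Splitting.slope, Splitting.graphFrame, Matrix.mul_zero, add_zero, inv_one,
      Matrix.mul_one, this]
    rw [Matrix.mul_assoc ξ.splittingAt.B, ← Matrix.mul_assoc ξ.splittingAt.Bᴴ,
      ξ.splittingAt.hBB, Matrix.one_mul]
  rw [tangentIncl_eq, Splitting.fderiv_graphMatrix, h]
  simp [Matrix.conjTranspose_mul, Matrix.mul_assoc]

/-- The coordinates of a tangent vector are recovered from its image in the space of matrices. -/
theorem conjTranspose_B_mul_tangentIncl_mul_A (ξ : Orbit d N) (U : OrbitModel d N) :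
    ξ.splittingAt.Bᴴ * ξ.tangentIncl U * ξ.splittingAt.A = ((N : ℂ) / d) • U := by
  rw [tangentIncl_eq_smul, Matrix.mul_smul, Matrix.smul_mul, Matrix.mul_add, Matrix.add_mul]
  simp only [← Matrix.mul_assoc, Splitting.hBB, Splitting.hBA]
  simp [Matrix.mul_assoc, Splitting.hAA]

theorem tangentIncl_injective (ξ : Orbit d N) : Function.Injective ξ.tangentIncl := by
  intro U V h
  have h' := congrArg (fun X => ξ.splittingAt.Bᴴ * X * ξ.splittingAt.A) h
  have h'' := ((ξ.conjTranspose_B_mul_tangentIncl_mul_A U).symm.trans h').trans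
    (ξ.conjTranspose_B_mul_tangentIncl_mul_A V)
  exact smul_right_injective (OrbitModel d N) (Splitting.scale_ne_zero hd.out hN.out) h''

theorem isHermitian_incl (ξ : Orbit d N) : ξ.inclᴴ = ξ.incl :=
  ((isOrbitMatrix_iff hd.out hN.out _).1 ξ.2).1

theorem incl_mul_incl (ξ : Orbit d N) : ξ.incl * ξ.incl = ((N : ℂ) / d) • ξ.incl :=
  ((isOrbitMatrix_iff hd.out hN.out _).1 ξ.2).2.1

theorem exists_lie_eq_tangentIncl (ξ : Orbit d N) (U : TangentSpace 𝓘(ℝ, OrbitModel d N) ξ) :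
    ∃ η : Matrix (Fin N) (Fin N) ℂ, ηᴴ = -η ∧ ξ.tangentIncl U = ⁅η, ξ.incl⁆ := by
  refine ⟨ξ.splittingAt.slope 0 U - (ξ.splittingAt.slope 0 U)ᴴ, ?_,
    (tangentIncl_eq ξ U).trans ((Splitting.fderiv_graphMatrix_eq_lie _ _ _).trans ?_)⟩
  · simp
  · rw [graphMatrix_splittingAt_zero]

theorem exists_tangentIncl_eq_lie (ξ : Orbit d N) {η : Matrix (Fin N) (Fin N) ℂ} (hη : ηᴴ = -η) :
    ∃ U : TangentSpace 𝓘(ℝ, OrbitModel d N) ξ, ξ.tangentIncl U = ⁅η, ξ.incl⁆ := by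
  let s := ξ.splittingAt
  have hs : ξ.incl = ((N : ℂ) / d) • (s.A * s.Aᴴ) := ξ.splittingAt_spec
  -- Since ξ = c A Aᴴ, the diagonal blocks of η commute with ξ. Only the block from span A to span B
  -- and its adjoint contribute.
  refine ⟨(s.Bᴴ * η * s.A : OrbitModel d N), ?_⟩
  rw [tangentIncl_eq_smul, Ring.lie_def, hs, Matrix.mul_smul, Matrix.smul_mul, ← smul_sub]
  change _ • (s.B * (s.Bᴴ * η * s.A) * s.Aᴴ + s.A * (s.Bᴴ * η * s.A)ᴴ * s.Bᴴ) = _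
  congr 1
  have hB : s.B * s.Bᴴ = 1 - s.A * s.Aᴴ := by rw [← s.hsum]; abel
  calc _ = s.B * s.Bᴴ * η * (s.A * s.Aᴴ) - s.A * s.Aᴴ * η * (s.B * s.Bᴴ) := by
        simp [Matrix.conjTranspose_mul, hη, Matrix.mul_assoc, sub_eq_add_neg]
    _ = _ := by
        rw [hB]
        simp only [Matrix.sub_mul, Matrix.mul_sub, Matrix.one_mul, Matrix.mul_one]
        simp only [Matrix.mul_assoc]
        abel

theorem range_tangentIncl (ξ : Orbit d N) : Set.range ξ.tangentIncl =
    {X | ∃ η : Matrix (Fin N) (Fin N) ℂ, ηᴴ = -η ∧ X = ⁅η, ξ.incl⁆} := by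
  ext X
  constructor
  · rintro ⟨U, rfl⟩
    exact ξ.exists_lie_eq_tangentIncl U
  · rintro ⟨η, hη, rfl⟩
    exact ξ.exists_tangentIncl_eq_lie hη

instance : Nonempty (Orbit d N) := by
  have hd' : (d : ℂ) ≠ 0 := by exact_mod_cast hd.out.ne'
  refine ⟨⟨Matrix.diagonal fun i => if (i : ℕ) < d then (N : ℂ) / d else 0, ?_⟩⟩
  rw [isOrbitMatrix_iff hd.out hN.out]
  refine ⟨?_, ?_, ?_⟩
  · rw [Matrix.isHermitian_diagonal_iff]
    intro i
    split_ifs <;> simp [IsSelfAdjoint]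
  · rw [Matrix.diagonal_mul_diagonal, ← Matrix.diagonal_smul]
    congr 1
    ext i
    split_ifs <;> simp [*]
  · rw [Matrix.trace_diagonal, ← Finset.sum_filter, Finset.sum_const, Fin.card_filter_val_lt]
    rw [min_eq_right hN.out, nsmul_eq_mul]
    field_simp

theorem incl_unitary_smul (U : Matrix.unitaryGroup (Fin N) ℂ) (ξ : Orbit d N) :
    (U • ξ).incl = (U : Matrix (Fin N) (Fin N) ℂ) * ξ.incl * (U : Matrix (Fin N) (Fin N) ℂ)ᴴ := rfl

instance : MulAction.IsPretransitive (Matrix.unitaryGroup (Fin N) ℂ) (Orbit d N) where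
  exists_smul_eq ξ η := by
    let s := ξ.splittingAt
    let t := η.splittingAt
    have hmul : ∀ s t r : Splitting d N, (t.A * s.Aᴴ + t.B * s.Bᴴ) * (s.A * r.Aᴴ + s.B * r.Bᴴ) =
        t.A * r.Aᴴ + t.B * r.Bᴴ := by
      intro s t r
      calc _ = t.A * (s.Aᴴ * s.A) * r.Aᴴ + t.A * (s.Aᴴ * s.B) * r.Bᴴ +
            t.B * (s.Bᴴ * s.A) * r.Aᴴ + t.B * (s.Bᴴ * s.B) * r.Bᴴ := by
            simp only [Matrix.add_mul, Matrix.mul_add, Matrix.mul_assoc]; abel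
        _ = _ := by simp [s.hAA, s.hAB, s.hBA, s.hBB]
    have hstar : (t.A * s.Aᴴ + t.B * s.Bᴴ)ᴴ = s.A * t.Aᴴ + s.B * t.Bᴴ := by
      simp [Matrix.conjTranspose_mul]
    -- The unitary that carries the orthonormal basis `s` to the basis `t`.
    refine ⟨⟨t.A * s.Aᴴ + t.B * s.Bᴴ, ?_⟩, Subtype.ext ?_⟩
    · rw [Matrix.mem_unitaryGroup_iff, Matrix.star_eq_conjTranspose, hstar, hmul, t.hsum]
    · change (t.A * s.Aᴴ + t.B * s.Bᴴ) * ξ.incl * (t.A * s.Aᴴ + t.B * s.Bᴴ)ᴴ = η.incl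
      have hs : ξ.incl = ((N : ℂ) / d) • (s.A * s.Aᴴ) := ξ.splittingAt_spec
      have ht : η.incl = ((N : ℂ) / d) • (t.A * t.Aᴴ) := η.splittingAt_spec
      rw [hs, ht, hstar, Matrix.mul_smul, Matrix.smul_mul]
      congr 1
      have h1 : (t.A * s.Aᴴ + t.B * s.Bᴴ) * s.A = t.A := by
        simp [Matrix.add_mul, Matrix.mul_assoc, s.hAA, s.hBA]
      have h2 : s.Aᴴ * (s.A * t.Aᴴ + s.B * t.Bᴴ) = t.Aᴴ := by
        simp [Matrix.mul_add, ← Matrix.mul_assoc, s.hAA, s.hAB]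
      rw [← Matrix.mul_assoc, h1, Matrix.mul_assoc, h2]

end Orbit

/-! ### The Kirillov–Kostant–Souriau form is symplectic -/

/-- Cyclicity of the trace moves the bracket from η onto ξ, so η' enters only through the tangent
vector ⁅η', ξ⁆. -/
theorem alphaPairing_lie {N : ℕ} (ξ : Matrix (Fin N) (Fin N) ℂ) {η η' : Matrix (Fin N) (Fin N) ℂ}
    (hη : ηᴴ = -η) (hη' : η'ᴴ = -η') :
    alphaPairing ξ ⁅η, η'⁆ = (-(Complex.I / 2) * (η * ⁅η', ξ⁆).trace).re := by
  have h : (⁅η, η'⁆ᴴ * ξ).trace = -(η * ⁅η', ξ⁆).trace := by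
    rw [Ring.lie_def, Ring.lie_def, Matrix.conjTranspose_sub, Matrix.conjTranspose_mul,
      Matrix.conjTranspose_mul, hη, hη', Matrix.mul_sub, Matrix.trace_sub, ← Matrix.mul_assoc,
      ← Matrix.mul_assoc, Matrix.trace_mul_comm (η * ξ), ← Matrix.mul_assoc]
    simp [Matrix.sub_mul, Matrix.trace_sub]
  rw [alphaPairing, h, mul_neg, neg_mul]

theorem alphaPairing_lie_swap {N : ℕ} (ξ η η' : Matrix (Fin N) (Fin N) ℂ) :
    alphaPairing ξ ⁅η, η'⁆ = -alphaPairing ξ ⁅η', η⁆ := by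
  simp only [alphaPairing, Ring.lie_def, Matrix.conjTranspose_sub, Matrix.sub_mul,
    Matrix.trace_sub, mul_sub, Complex.sub_re]
  ring

/-- `α_ξ(⁅η, η'⁆)` depends only on the tangent vectors `⁅η, ξ⁆` and `⁅η', ξ⁆`. -/
theorem alphaPairing_lie_congr {N : ℕ} {ξ η η' ζ ζ' : Matrix (Fin N) (Fin N) ℂ}
    (hη : ηᴴ = -η) (hη' : η'ᴴ = -η') (hζ : ζᴴ = -ζ) (hζ' : ζ'ᴴ = -ζ')
    (h : ⁅η, ξ⁆ = ⁅ζ, ξ⁆) (h' : ⁅η', ξ⁆ = ⁅ζ', ξ⁆) :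
    alphaPairing ξ ⁅η, η'⁆ = alphaPairing ξ ⁅ζ, ζ'⁆ := by
  -- Replace η' by ζ' first, then use antisymmetry to replace η by ζ in the same way.
  rw [alphaPairing_lie ξ hη hη', h', ← alphaPairing_lie ξ hη hζ', alphaPairing_lie_swap,
    alphaPairing_lie ξ hζ' hη, h, ← alphaPairing_lie ξ hζ' hζ, ← alphaPairing_lie_swap]

namespace Orbit

variable {d N : ℕ} [hd : Fact (0 < d)] [hN : Fact (d ≤ N)]

theorem conjTranspose_lift (ξ : Orbit d N) {X : Matrix (Fin N) (Fin N) ℂ} (hX : Xᴴ = X) :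
    (ξ.lift X)ᴴ = -ξ.lift X := by
  rw [lift, Ring.lie_def, Matrix.conjTranspose_smul, Matrix.conjTranspose_sub,
    Matrix.conjTranspose_mul, Matrix.conjTranspose_mul, hX, ξ.isHermitian_incl, star_trivial,
    ← smul_neg, neg_sub]

theorem conjTranspose_lie_incl (ξ : Orbit d N) {η : Matrix (Fin N) (Fin N) ℂ} (hη : ηᴴ = -η) :
    ⁅η, ξ.incl⁆ᴴ = ⁅η, ξ.incl⁆ := by
  rw [Ring.lie_def, Matrix.conjTranspose_sub,
    Matrix.conjTranspose_mul, Matrix.conjTranspose_mul, hη, ξ.isHermitian_incl]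
  simp only [Matrix.mul_neg, Matrix.neg_mul]
  abel

/-- The eigenvalues of ad ξ are 0 and ±c, so (ad ξ)³ = c² ad ξ; the factor (d/N)² in `lift` is c⁻².
-/
theorem lie_lift_lie (ξ : Orbit d N) (η : Matrix (Fin N) (Fin N) ℂ) :
    ⁅ξ.lift ⁅η, ξ.incl⁆, ξ.incl⁆ = ⁅η, ξ.incl⁆ := by
  have hd' : (d : ℂ) ≠ 0 := by exact_mod_cast hd.out.ne'
  have hN' : (N : ℂ) ≠ 0 := by
    have : 0 < N := hd.out.trans_le hN.out
    exact_mod_cast this.ne'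
  have h2 := ξ.incl_mul_incl
  have h : ⁅⁅⁅η, ξ.incl⁆, ξ.incl⁆, ξ.incl⁆ = ((N : ℂ) / d) ^ 2 • ⁅η, ξ.incl⁆ := by
    simp only [Ring.lie_def]
    generalize ξ.incl = P at *
    generalize (N : ℂ) / d = c at *
    have h3 : ∀ X, P * (P * X) = c • (P * X) := fun X => by
      rw [← Matrix.mul_assoc, h2, Matrix.smul_mul]
    simp only [Matrix.sub_mul, Matrix.mul_sub, Matrix.mul_assoc, h2, h3, Matrix.mul_smul,
      Matrix.smul_mul, smul_sub, smul_smul, ← sq]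
    abel
  rw [lift, smul_lie_matrix, h, ← smul_assoc]
  have : ((d : ℝ) / N) ^ 2 • ((N : ℂ) / d) ^ 2 = 1 := by
    rw [Complex.real_smul]
    push_cast
    field_simp
  rw [this, one_smul]

/-- The form in terms of arbitrary generators of the tangent vectors. -/
theorem ambientKKS_lie (ξ : Orbit d N) {η η' : Matrix (Fin N) (Fin N) ℂ}
    (hη : ηᴴ = -η) (hη' : η'ᴴ = -η') :
    ξ.ambientKKS ![⁅η, ξ.incl⁆, ⁅η', ξ.incl⁆] = alphaPairing ξ.incl ⁅η, η'⁆ :=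
  alphaPairing_lie_congr (ξ.conjTranspose_lift (ξ.conjTranspose_lie_incl hη))
    (ξ.conjTranspose_lift (ξ.conjTranspose_lie_incl hη')) hη hη' (ξ.lie_lift_lie η)
    (ξ.lie_lift_lie η')

theorem kksForm_apply (ξ : Orbit d N) (v w : TangentSpace 𝓘(ℝ, OrbitModel d N) ξ) :
    kksForm d N ξ ![v, w] = ξ.ambientKKS ![ξ.tangentIncl v, ξ.tangentIncl w] := rfl

theorem kksForm_eq_alphaPairing (ξ : Orbit d N) (v w : TangentSpace 𝓘(ℝ, OrbitModel d N) ξ)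
    (η η' : Matrix (Fin N) (Fin N) ℂ) (hη : ηᴴ = -η) (hη' : η'ᴴ = -η')
    (hv : ξ.tangentIncl v = ⁅η, ξ.incl⁆) (hw : ξ.tangentIncl w = ⁅η', ξ.incl⁆) :
    kksForm d N ξ ![v, w] = alphaPairing ξ.incl ⁅η, η'⁆ := by
  rw [kksForm_apply, hv, hw, ambientKKS_lie ξ hη hη']

end Orbit

theorem isCoadjointOrbit (d N : ℕ) [Fact (0 < d)] [Fact (d ≤ N)] : IsCoadjointOrbit d N where
  isManifold := inferInstance
  smooth_incl := Orbit.contMDiff_incl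
  injective := Orbit.tangentIncl_injective
  range_eq := Orbit.range_tangentIncl
  nonempty := inferInstance
  transitive := inferInstance
  kks := Orbit.kksForm_eq_alphaPairing

/-! ### Closed `2`-forms from bilinear maps -/

section BilinearForm

variable {E F : Type*} [NormedAddCommGroup E] [NormedSpace ℝ E] [NormedAddCommGroup F]
  [NormedSpace ℝ F]

theorem IsBoundedBilinearMap.continuousLinearMap_comp {G H : Type*} [NormedAddCommGroup G]
    [NormedSpace ℝ G] [NormedAddCommGroup H] [NormedSpace ℝ H] {B : F × E → G}
    (hB : IsBoundedBilinearMap ℝ B) (L : G →L[ℝ] H) :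
    IsBoundedBilinearMap ℝ (fun p => L (B p)) :=
  (L.compL ℝ E G H ∘L hB.toContinuousLinearMap).isBoundedBilinearMap

/-- The `1`-form `v ↦ B (f x, v)`. -/
def bilinearOneForm {B : F × E → ℝ} (hB : IsBoundedBilinearMap ℝ B) (f : E → F) (x : E) :
    E [⋀^Fin 1]→L[ℝ] ℝ :=
  ContinuousAlternatingMap.ofSubsingletonLIE (0 : Fin 1) (hB.toContinuousLinearMap (f x))

variable {B : F × E → ℝ} (hB : IsBoundedBilinearMap ℝ B) {f : E → F}

theorem contDiff_bilinearOneForm (hf : ContDiff ℝ ∞ f) :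
    ContDiff ℝ ∞ (bilinearOneForm hB f) :=
  (ContinuousAlternatingMap.ofSubsingletonLIE (𝕜 := ℝ) (E := E) (F := ℝ) (0 : Fin 1)).contDiff.comp
    (hB.toContinuousLinearMap.contDiff.comp hf)

theorem contDiff_extDeriv_bilinearOneForm (hf : ContDiff ℝ ∞ f) :
    ContDiff ℝ ∞ (extDeriv (bilinearOneForm hB f)) := by
  have h : extDeriv (bilinearOneForm hB f) = fun x =>
      ContinuousAlternatingMap.alternatizeUncurryFinCLM ℝ E ℝ
        (fderiv ℝ (bilinearOneForm hB f) x) := rfl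
  rw [h]
  exact ContinuousLinearMap.contDiff _ |>.comp
    ((contDiff_bilinearOneForm hB hf).fderiv_right (m := ∞) (by simp))

theorem extDeriv_extDeriv_bilinearOneForm (hf : ContDiff ℝ ∞ f) :
    extDeriv (extDeriv (bilinearOneForm hB f)) = 0 :=
  extDeriv_extDeriv (contDiff_bilinearOneForm hB hf)
    (by rw [minSmoothness_of_isRCLikeNormedField]; exact WithTop.coe_le_coe.2 (le_top : (2 : ℕ∞) ≤ ⊤))

/-- The bilinear map has constant coefficients, so only `f` is differentiated, and the exterior
derivative antisymmetrizes the result. -/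
theorem extDeriv_bilinearOneForm_apply {x : E} (hf : DifferentiableAt ℝ f x) (u v : E) :
    extDeriv (bilinearOneForm hB f) x ![u, v] =
      B (fderiv ℝ f x u, v) - B (fderiv ℝ f x v, u) := by
  have h : HasFDerivAt (bilinearOneForm hB f) _ x :=
    ((ContinuousAlternatingMap.ofSubsingletonLIE (𝕜 := ℝ) (E := E) (F := ℝ)
      (0 : Fin 1)).toContinuousLinearEquiv.hasFDerivAt).comp x
      (hB.toContinuousLinearMap.hasFDerivAt.comp x hf.hasFDerivAt)
  rw [extDeriv, ContinuousAlternatingMap.alternatizeUncurryFin_apply, Fin.sum_univ_two, h.fderiv]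
  simp [Fin.removeNth, sub_eq_add_neg]

end BilinearForm

/-! ### The form and its primitive in a graph chart -/

namespace Splitting

variable {d N : ℕ}

/-- The pairing of the velocities of the graph projection, in the coordinate `Z`. -/
theorem alphaPairing_slope (hd : 0 < d) (hN : d ≤ N) (s : Splitting d N)
    (Z U V : Matrix (Fin (N - d)) (Fin d) ℂ) :
    alphaPairing (s.graphMatrix Z) ⁅s.slope Z U - (s.slope Z U)ᴴ, s.slope Z V - (s.slope Z V)ᴴ⁆ =
      -((N : ℝ) / d) * (((s.slope Z U)ᴴ * s.slope Z V).trace).im := by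
  have hc : ∀ z : ℂ, (-(Complex.I / 2) * ((N : ℂ) / d * (star z - z))).re =
      -((N : ℝ) / d) * z.im := by
    intro z
    have hz : star z - z = -(2 * z.im : ℝ) * Complex.I := by
      apply Complex.ext <;> simp
      ring
    rw [hz, show -(Complex.I / 2) * ((N : ℂ) / d * (-(2 * z.im : ℝ) * Complex.I)) =
      (Complex.I * Complex.I) * (((N : ℝ) / d * z.im : ℝ)) by push_cast; ring, Complex.I_mul_I]
    simp
  rw [alphaPairing_lie _ (by simp) (by simp), ← fderiv_graphMatrix_eq_lie, fderiv_graphMatrix,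
    ← hc, Matrix.mul_smul, Matrix.trace_smul, smul_eq_mul]
  -- With z = tr(S_Uᴴ S_V), the products S_U S_V and S_Uᴴ S_Vᴴ vanish, and the two mixed traces are
  -- conj z and z.
  congr 4
  have h0 := slope_mul_slope hd hN s Z U V
  have h1 : (s.slope Z U)ᴴ * (s.slope Z V)ᴴ = 0 := by
    rw [← Matrix.conjTranspose_mul, slope_mul_slope hd hN, Matrix.conjTranspose_zero]
  rw [← Matrix.trace_conjTranspose, Matrix.conjTranspose_mul, Matrix.conjTranspose_conjTranspose,
    Matrix.trace_mul_comm _ (s.slope Z U), ← Matrix.trace_sub, Matrix.sub_mul, Matrix.mul_add,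
    Matrix.mul_add, h0, h1]
  simp

variable (d N) in
/-- The pairing `(M, V) ↦ -(c / 2) Im tr (M V)`, where `c = N / d`. -/
def imTracePairing (p : Matrix (Fin d) (Fin (N - d)) ℂ × OrbitModel d N) : ℝ :=
  -((N : ℝ) / d / 2) * ((p.1 * p.2).trace).im

theorem isBoundedBilinearMap_imTracePairing : IsBoundedBilinearMap ℝ (imTracePairing d N) :=
  isBoundedBilinearMap_matrix_mul.continuousLinearMap_comp
    ((-((N : ℝ) / d / 2)) • (Complex.imCLM ∘L traceCLM (Fin d)))

variable (d N) in
/-- A primitive of the form in every graph chart: `V ↦ -(c / 2) Im tr ((1 + Zᴴ Z)⁻¹ Zᴴ V)`. -/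
def primitive (Z : OrbitModel d N) :=
  bilinearOneForm (isBoundedBilinearMap_imTracePairing (d := d) (N := N))
    (fun Z => (1 + Zᴴ * Z)⁻¹ * Zᴴ) Z

theorem contDiff_inv_gram_mul_conjTranspose :
    ContDiff ℝ ∞ (fun Z : OrbitModel d N => (1 + Zᴴ * Z)⁻¹ * Zᴴ) := by
  rw [← contDiffOn_univ]
  exact contDiff_inv_gram.contDiffOn.matrix_mul contDiffOn_id.matrix_conjTranspose

theorem fderiv_inv_gram_mul_conjTranspose (Z U : OrbitModel d N) :
    fderiv ℝ (fun Z : OrbitModel d N => (1 + Zᴴ * Z)⁻¹ * Zᴴ) Z U =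
      (1 + Zᴴ * Z)⁻¹ * Uᴴ - (1 + Zᴴ * Z)⁻¹ * (Uᴴ * Z + Zᴴ * U) * (1 + Zᴴ * Z)⁻¹ * Zᴴ := by
  have hZ : HasDerivAt (fun t : ℝ => Z + t • U) U 0 := by
    simpa using ((hasDerivAt_id (0 : ℝ)).smul_const U).const_add Z
  have hK := ((hZ.matrix_conjTranspose.matrix_mul hZ).const_add 1).matrix_inv (isUnit_gram _)
  have h := hK.matrix_mul hZ.matrix_conjTranspose
  have hf := ((contDiff_inv_gram_mul_conjTranspose.differentiable (by simp)).differentiableAt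
    (x := Z)).hasFDerivAt.hasLineDerivAt U
  rw [hf.unique h]
  simp only [zero_smul, add_zero, Matrix.neg_mul]
  rw [neg_add_eq_sub]

/-- On antisymmetrizing, the term K⁻¹ZᴴU K⁻¹ZᴴV is symmetric in U and V under the trace and cancels
(`e3`). Exchanging U and V conjugates each of the other two traces (`e1`, `e2`), which doubles the
imaginary part and absorbs the ½ in the primitive. -/
theorem extDeriv_primitive_apply (Z U V : OrbitModel d N) :
    extDeriv (primitive d N) Z ![U, V] = -((N : ℝ) / d) * (((1 + Zᴴ * Z)⁻¹ * Uᴴ * V).trace -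
      ((1 + Zᴴ * Z)⁻¹ * Uᴴ * Z * (1 + Zᴴ * Z)⁻¹ * Zᴴ * V).trace).im := by
  have h := extDeriv_bilinearOneForm_apply (isBoundedBilinearMap_imTracePairing (d := d) (N := N))
    ((contDiff_inv_gram_mul_conjTranspose.differentiable (by simp)).differentiableAt (x := Z)) U V
  rw [fderiv_inv_gram_mul_conjTranspose, fderiv_inv_gram_mul_conjTranspose] at h
  refine h.trans ?_
  simp only [imTracePairing, Matrix.sub_mul, Matrix.trace_sub]
  have hK := conjTranspose_inv_gram Z
  generalize (1 + Zᴴ * Z)⁻¹ = K at *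
  have e1 : (K * Vᴴ * U).trace = star (K * Uᴴ * V).trace := by
    rw [← Matrix.trace_conjTranspose]
    simp only [Matrix.conjTranspose_mul, Matrix.conjTranspose_conjTranspose, hK]
    rw [Matrix.mul_assoc, Matrix.trace_mul_comm K, Matrix.mul_assoc]
  have e2 : (K * Vᴴ * Z * K * Zᴴ * U).trace = star (K * Uᴴ * Z * K * Zᴴ * V).trace := by
    rw [← Matrix.trace_conjTranspose]
    simp only [Matrix.conjTranspose_mul, Matrix.conjTranspose_conjTranspose, hK]
    simp only [Matrix.mul_assoc]
    rw [Matrix.trace_mul_comm K]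
    simp only [Matrix.mul_assoc]
  have e3 : (K * Zᴴ * V * K * Zᴴ * U).trace = (K * Zᴴ * U * K * Zᴴ * V).trace := by
    rw [Matrix.mul_assoc (K * Zᴴ * V * K), Matrix.mul_assoc (K * Zᴴ * V), Matrix.trace_mul_comm]
    simp only [← Matrix.mul_assoc]
  have key : ∀ A B : Matrix (Fin (N - d)) (Fin d) ℂ, (K * (Aᴴ * Z + Zᴴ * A) * K * Zᴴ * B).trace =
      (K * Aᴴ * Z * K * Zᴴ * B).trace + (K * Zᴴ * A * K * Zᴴ * B).trace := by
    intro A B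
    rw [← Matrix.trace_add]
    simp only [Matrix.mul_add, Matrix.add_mul, ← Matrix.mul_assoc]
  rw [key, key, e1, e2, e3]
  simp
  ring

end Splitting

theorem TwoForm.inChart_apply {E M : Type*} [NormedAddCommGroup E] [NormedSpace ℝ E]
    [TopologicalSpace M] [ChartedSpace E M] (Ω : TwoForm E M) (p : M) (y u v : E) :
    Ω.inChart p y ![u, v] = Ω ((chartAt E p).symm y)
      ![mfderiv 𝓘(ℝ, E) 𝓘(ℝ, E) (chartAt E p).symm y u,
        mfderiv 𝓘(ℝ, E) 𝓘(ℝ, E) (chartAt E p).symm y v] := by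
  refine congrArg (Ω ((chartAt E p).symm y)) (funext fun i => ?_)
  fin_cases i <;> rfl

/-! ### Closedness and nondegeneracy on the orbit -/

namespace Orbit

variable {d N : ℕ} [hd : Fact (0 < d)] [hN : Fact (d ≤ N)]

/-- The inclusion after the inverse chart is `graphMatrix` by definition, so this is the chain rule.
-/
theorem tangentIncl_mfderiv_chartAt_symm (ξ : Orbit d N) (Z U : OrbitModel d N) :
    ((chartAt (OrbitModel d N) ξ).symm Z).tangentIncl
      (mfderiv 𝓘(ℝ, OrbitModel d N) 𝓘(ℝ, OrbitModel d N) (chartAt (OrbitModel d N) ξ).symm Z U) =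
    fderiv ℝ ξ.splittingAt.graphMatrix Z U := by
  have h := mdifferentiableAt_atlas_symm (I := 𝓘(ℝ, OrbitModel d N)) (M := Orbit d N)
    (chart_mem_atlas (OrbitModel d N) ξ) (show Z ∈ (chartAt (OrbitModel d N) ξ).target from trivial)
  have h' := mfderiv_comp Z (mdifferentiableAt_incl ((chartAt (OrbitModel d N) ξ).symm Z)) h
  have h'' : mfderiv 𝓘(ℝ, OrbitModel d N) 𝓘(ℝ, Matrix (Fin N) (Fin N) ℂ)
      ξ.splittingAt.graphMatrix Z = fderiv ℝ ξ.splittingAt.graphMatrix Z := mfderiv_eq_fderiv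
  exact (DFunLike.congr_fun h' U).symm.trans (DFunLike.congr_fun h'' U)

/-- Both sides equal -c Im tr(S_Uᴴ S_V). The right side does not involve ξ: the form has one and the
same exact expression in all preferred charts, which gives smoothness and closedness at once. -/
theorem kksForm_inChart (ξ : Orbit d N) :
    (kksForm d N).inChart ξ = extDeriv (Splitting.primitive d N) := by
  funext Z
  refine ContinuousAlternatingMap.ext fun v => ?_
  have hv : v = ![v 0, v 1] := by ext i; fin_cases i <;> rfl
  let p : Orbit d N := (chartAt (OrbitModel d N) ξ).symm Z
  have hp : p.incl = ξ.splittingAt.graphMatrix Z := rfl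
  have h : ∀ U : OrbitModel d N, p.tangentIncl (mfderiv 𝓘(ℝ, OrbitModel d N) 𝓘(ℝ, OrbitModel d N)
      (chartAt (OrbitModel d N) ξ).symm Z U) =
      ⁅ξ.splittingAt.slope Z U - (ξ.splittingAt.slope Z U)ᴴ, p.incl⁆ := fun U =>
    (tangentIncl_mfderiv_chartAt_symm ξ Z U).trans (Splitting.fderiv_graphMatrix_eq_lie _ _ _)
  rw [hv, Splitting.extDeriv_primitive_apply, ← Splitting.trace_slope ξ.splittingAt,
    ← Splitting.alphaPairing_slope hd.out hN.out, ← hp]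
  exact (TwoForm.inChart_apply _ _ _ _ _).trans
    (kksForm_eq_alphaPairing p _ _ _ _ (by simp) (by simp) (h (v 0)) (h (v 1)))

/-- Evaluation at the centre Z = 0, where K = 1 and the second trace in `trace_slope` vanishes. -/
theorem kksForm_eq_im_trace (ξ : Orbit d N) (U V : OrbitModel d N) :
    kksForm d N ξ ![U, V] = -((N : ℝ) / d) * ((Uᴴ * V).trace).im := by
  have h : ∀ U : OrbitModel d N, ξ.tangentIncl U =
      ⁅ξ.splittingAt.slope 0 U - (ξ.splittingAt.slope 0 U)ᴴ, ξ.incl⁆ := fun U => by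
    rw [← graphMatrix_splittingAt_zero, ← Splitting.fderiv_graphMatrix_eq_lie]
    exact tangentIncl_eq ξ U
  refine (kksForm_eq_alphaPairing ξ _ _ _ _ (by simp) (by simp) (h U) (h V)).trans ?_
  rw [← graphMatrix_splittingAt_zero, Splitting.alphaPairing_slope hd.out hN.out,
    Splitting.trace_slope]
  simp

open scoped ComplexOrder in
theorem kksForm_nondegenerate (ξ : Orbit d N) (X : TangentSpace 𝓘(ℝ, OrbitModel d N) ξ)
    (h : ∀ Y : TangentSpace 𝓘(ℝ, OrbitModel d N) ξ, kksForm d N ξ ![X, Y] = 0) : X = 0 := by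
  let U : OrbitModel d N := X
  have hc : (N : ℝ) / d ≠ 0 := by
    have h1 : 0 < d := hd.out
    have h2 : 0 < N := h1.trans_le hN.out
    positivity
  have hV : ∀ V : OrbitModel d N, ((Uᴴ * V).trace).im = 0 := fun V => by
    have := (ξ.kksForm_eq_im_trace U V).symm.trans (h V)
    simpa [hc] using this
  -- Testing against U and iU gives the imaginary and real parts of tr(UᴴU), which must then vanish.
  have h1 := hV U
  have h2 := hV (Complex.I • U)
  rw [Matrix.mul_smul, Matrix.trace_smul, smul_eq_mul, Complex.I_mul_im] at h2
  exact Matrix.trace_conjTranspose_mul_self_eq_zero_iff.1 (Complex.ext h2 h1)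

theorem isSymplectic_kksForm : IsSymplectic (kksForm d N) where
  isManifold := inferInstance
  smooth ξ := by
    rw [kksForm_inChart]
    exact (contDiff_extDeriv_bilinearOneForm _
      Splitting.contDiff_inv_gram_mul_conjTranspose).contDiffOn
  closed ξ Z _ := by
    rw [kksForm_inChart]
    exact congrFun (extDeriv_extDeriv_bilinearOneForm _
      Splitting.contDiff_inv_gram_mul_conjTranspose) Z
  nondegenerate := kksForm_nondegenerate

end Orbit

/-! ### Tight frames -/

namespace TightFrame

variable {d N : ℕ}

theorem continuous_mat : Continuous (mat : TightFrame d N → _) := continuous_subtype_val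

/-- The frame equation is closed, and it bounds F because ‖F‖² = ‖FFᴴ‖ is prescribed. Compactness
makes the inverse of the Gram bijection continuous. -/
instance : CompactSpace (TightFrame d N) := by
  have : ProperSpace (Matrix (Fin d) (Fin N) ℂ) :=
    FiniteDimensional.proper ℂ (Matrix (Fin d) (Fin N) ℂ)
  refine isCompact_iff_compactSpace.1 (Metric.isCompact_of_isClosed_isBounded
    (s := {F : Matrix (Fin d) (Fin N) ℂ | F * Fᴴ = ((N : ℂ) / d) • (1 : Matrix (Fin d) (Fin d) ℂ)})
    ?_ ?_)
  · exact isClosed_eq (continuous_id.matrix_mul continuous_id.matrix_conjTranspose)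
      continuous_const
  · refine isBounded_iff_forall_norm_le.2
      ⟨‖((N : ℂ) / d) • (1 : Matrix (Fin d) (Fin d) ℂ)‖ + 1, fun F hF => ?_⟩
    have h := Matrix.l2_opNorm_conjTranspose_mul_self Fᴴ
    rw [Matrix.conjTranspose_conjTranspose, hF, Matrix.l2_opNorm_conjTranspose] at h
    rw [h]
    nlinarith [sq_nonneg (‖F‖ - 1)]

theorem star_scale : star ((N : ℂ) / d)⁻¹ = ((N : ℂ) / d)⁻¹ := by simp

/-- A skew-Hermitian generator of the image under `d(Fᴴ F)` of a tangent vector `X`. -/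
def generator (F : TightFrame d N) (X : Matrix (Fin d) (Fin N) ℂ) : Matrix (Fin N) (Fin N) ℂ :=
  ((N : ℂ) / d)⁻¹ • (Xᴴ * F.mat - F.matᴴ * X)

theorem conjTranspose_generator (F : TightFrame d N) (X : Matrix (Fin d) (Fin N) ℂ) :
    (F.generator X)ᴴ = -F.generator X := by
  simp only [generator, Matrix.conjTranspose_smul, star_scale, Matrix.conjTranspose_sub,
    Matrix.conjTranspose_mul, Matrix.conjTranspose_conjTranspose, ← smul_neg, neg_sub]

theorem IsTangent.mul_conjTranspose {F : TightFrame d N} {X : Matrix (Fin d) (Fin N) ℂ}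
    (hX : F.IsTangent X) : F.mat * Xᴴ = -(X * F.matᴴ) :=
  eq_neg_of_add_eq_zero_right hX

theorem isTangent_mul {F : TightFrame d N} {η : Matrix (Fin N) (Fin N) ℂ} (hη : ηᴴ = -η) :
    F.IsTangent (-(F.mat * η)) := by
  simp [IsTangent, Matrix.conjTranspose_mul, hη, Matrix.mul_assoc]

variable [hd : Fact (0 < d)] [hN : Fact (d ≤ N)]

theorem incl_gram (F : TightFrame d N) : F.gram.incl = F.matᴴ * F.mat := rfl

theorem continuous_gram : Continuous (gram : TightFrame d N → Orbit d N) :=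
  (continuous_mat.matrix_conjTranspose.matrix_mul continuous_mat).subtype_mk _

theorem gram_surjective : Function.Surjective (gram : TightFrame d N → Orbit d N) := by
  intro ξ
  have hs := ξ.splittingAt_spec
  -- If ξ = c A Aᴴ, then √c Aᴴ is a tight frame with Gram matrix ξ; r is √c.
  obtain ⟨r, hstar, hr⟩ : ∃ r : ℂ, star r = r ∧ r * r = (N : ℂ) / d := by
    refine ⟨(√((N : ℝ) / d) : ℝ), Complex.conj_ofReal _, ?_⟩
    rw [← Complex.ofReal_mul, Real.mul_self_sqrt (by positivity)]
    push_cast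
    rfl
  refine ⟨⟨r • ξ.splittingAt.Aᴴ, ?_⟩, Subtype.ext ?_⟩
  · rw [Matrix.conjTranspose_smul, hstar, Matrix.smul_mul, Matrix.mul_smul, smul_smul, hr,
      Matrix.conjTranspose_conjTranspose, ξ.splittingAt.hAA]
  · change (r • ξ.splittingAt.Aᴴ)ᴴ * (r • ξ.splittingAt.Aᴴ) = ξ.incl
    rw [hs, Matrix.conjTranspose_smul, hstar, Matrix.smul_mul, Matrix.mul_smul, smul_smul, hr,
      Matrix.conjTranspose_conjTranspose]

/-- Two tight frames with the same Gram matrix are unitarily equivalent. -/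
theorem exists_unitary_smul_eq {F F' : TightFrame d N} (h : F.gram = F'.gram) :
    ∃ A : Matrix.unitaryGroup (Fin d) ℂ, A • F' = F := by
  have hc := Splitting.scale_ne_zero hd.out hN.out
  have hF := F.mat_mul
  have h' : F.matᴴ * F.mat = F'.matᴴ * F'.mat := congrArg Orbit.incl h
  have hs : star ((N : ℂ) / d)⁻¹ = ((N : ℂ) / d)⁻¹ := by simp
  -- If F = A F', multiplying by F'ᴴ on the right forces A = c⁻¹ F F'ᴴ.
  refine ⟨⟨((N : ℂ) / d)⁻¹ • (F.mat * F'.matᴴ), ?_⟩, Subtype.ext ?_⟩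
  · rw [Matrix.mem_unitaryGroup_iff, Matrix.star_eq_conjTranspose, Matrix.conjTranspose_smul, hs,
      Matrix.smul_mul, Matrix.mul_smul, Matrix.conjTranspose_mul,
      Matrix.conjTranspose_conjTranspose, Matrix.mul_assoc, ← Matrix.mul_assoc F'.matᴴ, ← h',
      Matrix.mul_assoc, hF, Matrix.mul_smul, Matrix.mul_smul, Matrix.mul_one, hF, smul_smul,
      smul_smul, smul_smul]
    generalize (N : ℂ) / d = c at *
    rw [show c⁻¹ * c⁻¹ * c * c = 1 by field_simp, one_smul]
  · change (((N : ℂ) / d)⁻¹ • (F.mat * F'.matᴴ)) * F'.mat = F.mat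
    rw [Matrix.smul_mul, Matrix.mul_assoc, ← h', ← Matrix.mul_assoc, hF, Matrix.smul_mul,
      Matrix.one_mul, smul_smul, inv_mul_cancel₀ hc, one_smul]

/-- A continuous bijection from a compact space to a Hausdorff space is a homeomorphism. -/
theorem isHomeomorph_gramClass : IsHomeomorph (gramClass (d := d) (N := N)) := by
  have : T2Space (Orbit d N) := inferInstanceAs (T2Space {ξ // IsOrbitMatrix d N ξ})
  rw [isHomeomorph_iff_continuous_bijective]
  refine ⟨continuous_gram.quotient_lift _, ?_, ?_⟩
  · rintro ⟨F⟩ ⟨F'⟩ h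
    exact Quotient.sound (exists_unitary_smul_eq h)
  · intro ξ
    obtain ⟨F, rfl⟩ := gram_surjective ξ
    exact ⟨Quotient.mk _ F, rfl⟩

/-- Tangency, F Xᴴ = -X Fᴴ, cancels the two middle terms of the bracket; FFᴴ = c turns the outer
ones into c(XᴴF + FᴴX). -/
theorem lie_generator {F : TightFrame d N} {X : Matrix (Fin d) (Fin N) ℂ} (hX : F.IsTangent X) :
    ⁅F.generator X, F.gram.incl⁆ = Xᴴ * F.mat + F.matᴴ * X := by
  have hc := Splitting.scale_ne_zero hd.out hN.out
  have hF := F.mat_mul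
  rw [generator, incl_gram, Ring.lie_def, Matrix.smul_mul, Matrix.mul_smul, ← smul_sub]
  have h : (Xᴴ * F.mat - F.matᴴ * X) * (F.matᴴ * F.mat) -
      F.matᴴ * F.mat * (Xᴴ * F.mat - F.matᴴ * X) = ((N : ℂ) / d) • (Xᴴ * F.mat + F.matᴴ * X) := by
    calc _ = Xᴴ * (F.mat * F.matᴴ) * F.mat - F.matᴴ * (X * F.matᴴ) * F.mat -
          F.matᴴ * (F.mat * Xᴴ) * F.mat + F.matᴴ * (F.mat * F.matᴴ) * X := by
          simp only [Matrix.sub_mul, Matrix.mul_sub, Matrix.mul_assoc]; abel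
      _ = _ := by
          rw [hF, hX.mul_conjTranspose]
          simp only [Matrix.mul_smul, Matrix.smul_mul, Matrix.mul_one, Matrix.mul_neg,
            Matrix.neg_mul, smul_add]
          abel
  rw [h, smul_smul, inv_mul_cancel₀ hc, one_smul]

theorem range_tangentIncl_gram (F : TightFrame d N) : Set.range F.gram.tangentIncl =
    {T | ∃ X, F.IsTangent X ∧ T = Xᴴ * F.mat + F.matᴴ * X} := by
  rw [Orbit.range_tangentIncl]
  ext T
  constructor
  · rintro ⟨η, hη, rfl⟩
    -- The velocity -Fη of the right action of U(N) on frames covers the conjugation field ⁅η, FᴴF⁆.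
    refine ⟨_, isTangent_mul hη, ?_⟩
    rw [incl_gram, Ring.lie_def]
    simp [Matrix.conjTranspose_mul, hη, Matrix.mul_assoc, sub_eq_add_neg]
  · rintro ⟨X, hX, rfl⟩
    exact ⟨F.generator X, F.conjTranspose_generator X, (lie_generator hX).symm⟩

theorem ker_gram (F : TightFrame d N) (X : Matrix (Fin d) (Fin N) ℂ) (hX : F.IsTangent X) :
    Xᴴ * F.mat + F.matᴴ * X = 0 ↔
      ∃ η : Matrix (Fin d) (Fin d) ℂ, ηᴴ = -η ∧ X = η * F.mat := by
  have hc := Splitting.scale_ne_zero hd.out hN.out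
  have hF := F.mat_mul
  constructor
  · intro h
    -- Forced by X = ηF and FFᴴ = c; tangency of X makes it skew-Hermitian.
    refine ⟨((N : ℂ) / d)⁻¹ • (X * F.matᴴ), ?_, ?_⟩
    · rw [Matrix.conjTranspose_smul, star_scale, Matrix.conjTranspose_mul,
        Matrix.conjTranspose_conjTranspose, hX.mul_conjTranspose, smul_neg]
    · have h' : F.mat * Xᴴ * F.mat + F.mat * F.matᴴ * X = 0 := by
        simpa [Matrix.mul_add, ← Matrix.mul_assoc] using congrArg (F.mat * ·) h
      rw [hX.mul_conjTranspose, hF, Matrix.smul_mul, Matrix.one_mul, Matrix.neg_mul,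
        neg_add_eq_zero] at h'
      rw [Matrix.smul_mul, h', smul_smul, inv_mul_cancel₀ hc, one_smul]
  · rintro ⟨η, hη, rfl⟩
    simp [Matrix.conjTranspose_mul, hη, Matrix.mul_assoc]

/-- Of the four traces, the two with both frame factors on the same side agree, since tangency is
used twice and the signs cancel (`h1`). The other two collapse by FFᴴ = c to c times conj z and z,
with z = tr(YᴴX). -/
theorem alphaPairing_generator {F : TightFrame d N} {X Y : Matrix (Fin d) (Fin N) ℂ}
    (hX : F.IsTangent X) (hY : F.IsTangent Y) :
    alphaPairing F.gram.incl ⁅F.generator X, F.generator Y⁆ = -((Yᴴ * X).trace).im := by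
  have hc := Splitting.scale_ne_zero hd.out hN.out
  have hF := F.mat_mul
  rw [alphaPairing_lie _ (F.conjTranspose_generator X) (F.conjTranspose_generator Y),
    lie_generator hY, generator, Matrix.smul_mul, Matrix.trace_smul, smul_eq_mul]
  have h1 : (Xᴴ * F.mat * (Yᴴ * F.mat)).trace = (F.matᴴ * X * (F.matᴴ * Y)).trace := by
    calc _ = ((F.mat * Xᴴ) * (F.mat * Yᴴ)).trace := by
          rw [← Matrix.mul_assoc, Matrix.trace_mul_comm]
          simp only [Matrix.mul_assoc]
      _ = ((Y * F.matᴴ) * (X * F.matᴴ)).trace := by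
          rw [hX.mul_conjTranspose, hY.mul_conjTranspose, neg_mul_neg, Matrix.trace_mul_comm]
      _ = _ := by
          rw [Matrix.mul_assoc, Matrix.trace_mul_comm]
          simp only [Matrix.mul_assoc]
  have h2 : (Xᴴ * F.mat * (F.matᴴ * Y)).trace = ((N : ℂ) / d) * (Xᴴ * Y).trace := by
    rw [Matrix.mul_assoc, ← Matrix.mul_assoc F.mat, hF, Matrix.smul_mul, Matrix.mul_smul,
      Matrix.trace_smul, Matrix.one_mul, smul_eq_mul]
  have h3 : (F.matᴴ * X * (Yᴴ * F.mat)).trace = ((N : ℂ) / d) * (Yᴴ * X).trace := by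
    rw [Matrix.trace_mul_comm, Matrix.mul_assoc, ← Matrix.mul_assoc F.mat, hF, Matrix.smul_mul,
      Matrix.mul_smul, Matrix.trace_smul, Matrix.one_mul, smul_eq_mul]
  have h4 : (Xᴴ * Y).trace = star (Yᴴ * X).trace := by
    rw [← Matrix.trace_conjTranspose, Matrix.conjTranspose_mul, Matrix.conjTranspose_conjTranspose]
  rw [Matrix.sub_mul, Matrix.mul_add, Matrix.mul_add, Matrix.trace_sub, Matrix.trace_add,
    Matrix.trace_add, h1, h2, h3, h4]
  generalize (F.matᴴ * X * (F.matᴴ * Y)).trace = w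
  generalize (Yᴴ * X).trace = z
  rw [show -(Complex.I / 2) * (((N : ℂ) / d)⁻¹ * (w + (N : ℂ) / d * star z -
    ((N : ℂ) / d * z + w))) = -(Complex.I / 2) * ((((N : ℂ) / d)⁻¹ * ((N : ℂ) / d)) *
      (star z - z)) by ring, inv_mul_cancel₀ hc]
  simp
  ring

theorem kksForm_gram (F : TightFrame d N) (X Y : Matrix (Fin d) (Fin N) ℂ)
    (hX : F.IsTangent X) (hY : F.IsTangent Y) (v w : TangentSpace 𝓘(ℝ, OrbitModel d N) F.gram)
    (hv : F.gram.tangentIncl v = Xᴴ * F.mat + F.matᴴ * X)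
    (hw : F.gram.tangentIncl w = Yᴴ * F.mat + F.matᴴ * Y) :
    Orbit.kksForm d N F.gram ![v, w] = -((Yᴴ * X).trace).im := by
  rw [← lie_generator hX] at hv
  rw [← lie_generator hY] at hw
  rw [Orbit.kksForm_eq_alphaPairing F.gram v w _ _ (F.conjTranspose_generator X)
    (F.conjTranspose_generator Y) hv hw, alphaPairing_generator hX hY]

theorem gram_torusAct (g : Fin N → Circle) (F : TightFrame d N) :
    (F.torusAct g).gram = torusToUnitary N g • F.gram := by
  refine Subtype.ext ?_
  change (F.mat * (torusToUnitary N g : Matrix (Fin N) (Fin N) ℂ)ᴴ)ᴴ *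
    (F.mat * (torusToUnitary N g : Matrix (Fin N) (Fin N) ℂ)ᴴ) =
    (torusToUnitary N g : Matrix (Fin N) (Fin N) ℂ) * (F.matᴴ * F.mat) *
      (torusToUnitary N g : Matrix (Fin N) (Fin N) ℂ)ᴴ
  simp [Matrix.conjTranspose_mul, Matrix.mul_assoc]

end TightFrame

theorem gramIsSymplectomorphism (d N : ℕ) [Fact (0 < d)] [Fact (d ≤ N)] :
    GramIsSymplectomorphism d N where
  isHomeomorph := TightFrame.isHomeomorph_gramClass
  equivariant := TightFrame.gram_torusAct
  range_eq := TightFrame.range_tangentIncl_gram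
  ker_eq := TightFrame.ker_gram
  pullback := TightFrame.kksForm_gram

/-! ### The Lie algebra of the torus -/

section MFDeriv

variable {E E' H M F : Type*} [NormedAddCommGroup E] [NormedSpace ℝ E] [NormedAddCommGroup E']
  [NormedSpace ℝ E'] [TopologicalSpace H] {I : ModelWithCorners ℝ E' H} [TopologicalSpace M]
  [ChartedSpace H M] [NormedAddCommGroup F] [NormedSpace ℝ F]

/-- The chain rule with tangent spaces of normed spaces replaced by the spaces themselves, so that
matrix identities apply to the values. -/
theorem HasFDerivAt.mfderiv_comp_apply {f : M → E} {x : M} {g : E → F} {g' : E →L[ℝ] F}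
    (hg : HasFDerivAt g g' (f x)) (hf : MDifferentiableAt I 𝓘(ℝ, E) f x)
    (v : TangentSpace I x) :
    (mfderiv I 𝓘(ℝ, F) (fun y => g (f y)) x v : F) = g' (mfderiv I 𝓘(ℝ, E) f x v : E) := by
  have h := hg.hasMFDerivAt.comp x hf.hasMFDerivAt
  exact DFunLike.congr_fun h.mfderiv v

theorem mfderiv_apply_congr {f f' : M → F} (h : f = f') (x : M) (v : TangentSpace I x) :
    (mfderiv I 𝓘(ℝ, F) f x v : F) = (mfderiv I 𝓘(ℝ, F) f' x v : F) := by
  subst h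
  rfl

theorem mfderiv_const_apply (c : F) (x : M) (v : TangentSpace I x) :
    (mfderiv I 𝓘(ℝ, F) (fun _ : M => c) x v : F) = 0 := by
  rw [mfderiv_const]
  rfl

end MFDeriv

namespace EffTorus

variable {n : ℕ}

theorem contMDiff_coe_apply (k : Fin n) :
    ContMDiff (torusModel (Fin n)) 𝓘(ℝ, ℂ) ∞ (fun g : EffTorus n => (g k : ℂ)) := by
  have : Fact (Module.finrank ℝ ℂ = 1 + 1) := finrank_real_complex_fact'
  have h : ContMDiff (𝓡 1) 𝓘(ℝ, ℂ) ∞ (fun z : Circle => (z : ℂ)) :=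
    contMDiff_coe_sphere (E := ℂ) (n := 1)
  exact h.comp (contMDiff_torus_apply k)

theorem mdifferentiableAt_coe_apply (k : Fin n) (g : EffTorus n) :
    MDifferentiableAt (torusModel (Fin n)) 𝓘(ℝ, ℂ) (fun g : EffTorus n => (g k : ℂ)) g :=
  (contMDiff_coe_apply k g).mdifferentiableAt (by simp)

/-- The velocity of an entry at the identity is imaginary. -/
theorem mfderiv_coe_apply_one (k : Fin n) (v : GroupLieAlgebra (torusModel (Fin n)) (EffTorus n)) :
    (mfderiv (torusModel (Fin n)) 𝓘(ℝ, ℂ) (fun g : EffTorus n => (g k : ℂ)) 1 v : ℂ) =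
      Complex.I * ((angle k v : ℝ) : ℂ) := by
  -- The function |z|² is constant on the circle and has derivative 2 Re at 1, so the real part of
  -- the velocity is zero.
  have h1 : HasFDerivAt (fun z : ℂ => ‖z‖ ^ 2) ((2 : ℝ) • Complex.reCLM)
      (((1 : EffTorus n) k : ℂ)) := by
    refine (hasFDerivAt_id (𝕜 := ℝ) (((1 : EffTorus n) k : ℂ))).norm_sq.congr_fderiv ?_
    ext z
    simp
  have h2 := h1.mfderiv_comp_apply (f := fun g : EffTorus n => (g k : ℂ)) (x := 1)
    (mdifferentiableAt_coe_apply k 1) v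
  have h3 : (fun g : EffTorus n => ‖(g k : ℂ)‖ ^ 2) = fun _ => (1 : ℝ) := by
    funext g
    rw [show ‖(g k : ℂ)‖ = 1 from Circle.norm_coe (g k), one_pow]
  rw [h3, mfderiv_const] at h2
  refine Complex.ext ?_ ?_
  · have h4 : (0 : ℝ) = 2 * (mfderiv (torusModel (Fin n)) 𝓘(ℝ, ℂ)
        (fun g : EffTorus n => (g k : ℂ)) 1 v : ℂ).re := h2
    rw [Complex.I_mul_re, Complex.ofReal_im]
    linarith
  · rw [Complex.I_mul_im, Complex.ofReal_re]
    rfl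

/-- The one-parameter group that rotates the `j`-th entry. -/
def rotation (j : Fin n) (t : ℝ) : EffTorus n := Pi.mulSingle j (Circle.exp t)

theorem contMDiff_rotation (j : Fin n) :
    ContMDiff 𝓘(ℝ, ℝ) (torusModel (Fin n)) ∞ (rotation j) := by
  rw [contMDiff_torus_iff]
  intro i
  by_cases h : i = j
  · subst h
    simpa [rotation] using contMDiff_circleExp
  · simpa [rotation, h] using contMDiff_const

/-- The generator of `rotation j`. -/
def rotationGenerator (j : Fin n) : GroupLieAlgebra (torusModel (Fin n)) (EffTorus n) :=
  (mfderiv 𝓘(ℝ, ℝ) (torusModel (Fin n)) (rotation j) 0 (1 : ℝ) : Fin n → EuclideanSpace ℝ (Fin 1))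

/-- The rotations provide vectors dual to the angles, which separates the coordinates of a
functional. -/
theorem angle_rotationGenerator (k j : Fin n) :
    angle k (rotationGenerator j) = if k = j then 1 else 0 := by
  have hr : rotation j 0 = 1 := by simp [rotation]
  have h := mfderiv_comp_apply_of_eq (x := (0 : ℝ)) (mdifferentiableAt_coe_apply k 1)
    ((contMDiff_rotation j 0).mdifferentiableAt (by simp)) hr (1 : ℝ)
  have h' : (fderiv ℝ (fun t : ℝ => ((rotation j t k : Circle) : ℂ)) 0 1).im =
      angle k (rotationGenerator j) := by
    rw [← mfderiv_eq_fderiv]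
    exact congrArg Complex.im h
  rw [← h', fderiv_apply_one_eq_deriv]
  split_ifs with hkj
  · subst hkj
    have : HasDerivAt (fun t : ℝ => ((rotation k t k : Circle) : ℂ)) Complex.I 0 := by
      simp only [rotation, Pi.mulSingle_eq_same, Circle.coe_exp]
      have h0 := (Complex.hasDerivAt_exp ((0 : ℝ) * Complex.I)).comp_of_eq (0 : ℝ)
        ((Complex.ofRealCLM.hasDerivAt (x := (0 : ℝ))).mul_const Complex.I) rfl
      exact h0.congr_deriv (by simp)
    rw [this.deriv, Complex.I_im]
  · simp [rotation, hkj]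

theorem dualOfCoords_apply (x : Fin n → ℝ)
    (v : GroupLieAlgebra (torusModel (Fin n)) (EffTorus n)) :
    dualOfCoords n x v = 1 / 2 * ∑ k, x k * angle k v := by
  simp [dualOfCoords]

variable (n) in
/-- `dualOfCoords` as a linear map. -/
def dualOfCoordsₗ :
    (Fin n → ℝ) →ₗ[ℝ] (GroupLieAlgebra (torusModel (Fin n)) (EffTorus n) →L[ℝ] ℝ) where
  toFun := dualOfCoords n
  map_add' x y := by simp [dualOfCoords, add_smul, Finset.sum_add_distrib]
  map_smul' c x := by
    simp only [dualOfCoords, Pi.smul_apply, smul_assoc, ← Finset.smul_sum, RingHom.id_apply]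
    rw [smul_comm]

theorem dualOfCoords_injective : Function.Injective (dualOfCoords n) := by
  intro x y h
  funext j
  have := DFunLike.congr_fun h (rotationGenerator j)
  simpa [dualOfCoords_apply, angle_rotationGenerator] using this

theorem finrank_dual (E : Type*) [NormedAddCommGroup E] [NormedSpace ℝ E]
    [FiniteDimensional ℝ E] : Module.finrank ℝ (E →L[ℝ] ℝ) = Module.finrank ℝ E := by
  rw [← (LinearMap.toContinuousLinearMap (𝕜 := ℝ) (E := E) (F' := ℝ)).finrank_eq]
  exact Subspace.dual_finrank_eq

theorem dualOfCoords_bijective : Function.Bijective (dualOfCoords n) := by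
  refine ⟨dualOfCoords_injective, ?_⟩
  -- The Lie algebra unfolds to n copies of a one-dimensional space, so injectivity suffices for
  -- bijectivity.
  have h1 : Module.finrank ℝ (GroupLieAlgebra (torusModel (Fin n)) (EffTorus n) →L[ℝ] ℝ) = n :=
    (finrank_dual (Fin n → EuclideanSpace ℝ (Fin 1))).trans
      (by rw [Module.finrank_pi_fintype]; simp)
  have : FiniteDimensional ℝ (GroupLieAlgebra (torusModel (Fin n)) (EffTorus n) →L[ℝ] ℝ) :=
    inferInstanceAs (FiniteDimensional ℝ ((Fin n → EuclideanSpace ℝ (Fin 1)) →L[ℝ] ℝ))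
  exact (LinearMap.injective_iff_surjective_of_finrank_eq_finrank (f := dualOfCoordsₗ n)
    (by rw [h1]; simp)).1 dualOfCoords_injective

theorem incl_castSucc (g : EffTorus n) (k : Fin n) : incl n g k.castSucc = g k :=
  Fin.snoc_castSucc (α := fun _ => Circle) ..

theorem incl_last (g : EffTorus n) : incl n g (Fin.last n) = 1 :=
  Fin.snoc_last (α := fun _ => Circle) ..

theorem mk_incl_bijective : Function.Bijective (fun g : EffTorus n =>
    (QuotientGroup.mk (incl n g) : (Fin (n + 1) → Circle) ⧸ scalarTorus (n + 1))) := by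
  constructor
  · intro g h hgh
    obtain ⟨z, hz⟩ := QuotientGroup.eq.1 hgh
    -- Both representatives have last entry 1, so the scalar between them is 1.
    have h1 := congrFun hz (Fin.last n)
    have hz1 : z = 1 := by simpa [incl_last] using h1
    funext k
    have h2 := congrFun hz k.castSucc
    simp only [Pi.constMonoidHom_apply, Function.const_apply, Pi.mul_apply, Pi.inv_apply,
      incl_castSucc, hz1] at h2
    exact inv_mul_eq_one.1 h2.symm
  · intro q
    obtain ⟨x, rfl⟩ := QuotientGroup.mk_surjective q
    -- Normalize by dividing every entry by the last one.
    refine ⟨fun k => x k.castSucc * (x (Fin.last n))⁻¹, QuotientGroup.eq.2 ⟨x (Fin.last n), ?_⟩⟩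
    funext k
    refine Fin.lastCases ?_ (fun i => ?_) k
    · simp [incl_last]
    · simp [incl_castSucc]

end EffTorus

/-! ### Invariance under the unitary group -/

namespace Orbit

variable {d N : ℕ} [hd : Fact (0 < d)] [hN : Fact (d ≤ N)]

/-- Conjugation `X ↦ U X Uᴴ` as a continuous linear map. -/
def conjugationCLM (U : Matrix (Fin N) (Fin N) ℂ) :
    Matrix (Fin N) (Fin N) ℂ →L[ℝ] Matrix (Fin N) (Fin N) ℂ where
  toFun X := U * X * Uᴴ
  map_add' X Y := by rw [Matrix.mul_add, Matrix.add_mul]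
  map_smul' c X := by rw [Matrix.mul_smul, Matrix.smul_mul]; rfl
  cont := (continuous_const.matrix_mul continuous_id).matrix_mul continuous_const

theorem contMDiff_unitary_smul (U : Matrix.unitaryGroup (Fin N) ℂ) :
    ContMDiff 𝓘(ℝ, OrbitModel d N) 𝓘(ℝ, OrbitModel d N) ∞ (fun ξ : Orbit d N => U • ξ) :=
  contMDiff_of_incl_comp ((conjugationCLM (U : Matrix (Fin N) (Fin N) ℂ)).contMDiff.comp
    contMDiff_incl)

/-- On the orbit the action restricts the linear map X ↦ U X Uᴴ, which is its own derivative. -/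
theorem tangentIncl_mfderiv_smul (U : Matrix.unitaryGroup (Fin N) ℂ) (ξ : Orbit d N)
    (X : TangentSpace 𝓘(ℝ, OrbitModel d N) ξ) :
    (U • ξ).tangentIncl (mfderiv 𝓘(ℝ, OrbitModel d N) 𝓘(ℝ, OrbitModel d N)
      (fun ξ : Orbit d N => U • ξ) ξ X) =
    (U : Matrix (Fin N) (Fin N) ℂ) * ξ.tangentIncl X * (U : Matrix (Fin N) (Fin N) ℂ)ᴴ := by
  have h1 := mfderiv_comp_apply ξ (mdifferentiableAt_incl (U • ξ))
    ((contMDiff_unitary_smul U ξ).mdifferentiableAt (by simp)) X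
  have h2 := (conjugationCLM (U : Matrix (Fin N) (Fin N) ℂ)).hasFDerivAt.mfderiv_comp_apply
    (mdifferentiableAt_incl ξ) X
  exact h1.symm.trans h2

/-- If η generates X at ξ, then UηUᴴ generates the image of X at U • ξ. Conjugation respects
brackets, and the trace is invariant under it. -/
theorem kksForm_unitary_smul (U : Matrix.unitaryGroup (Fin N) ℂ) (ξ : Orbit d N)
    (X Y : TangentSpace 𝓘(ℝ, OrbitModel d N) ξ) :
    kksForm d N (U • ξ) ![mfderiv 𝓘(ℝ, OrbitModel d N) 𝓘(ℝ, OrbitModel d N)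
      (fun ξ : Orbit d N => U • ξ) ξ X, mfderiv 𝓘(ℝ, OrbitModel d N) 𝓘(ℝ, OrbitModel d N)
      (fun ξ : Orbit d N => U • ξ) ξ Y] = kksForm d N ξ ![X, Y] := by
  obtain ⟨η, hη, hX⟩ := ξ.exists_lie_eq_tangentIncl X
  obtain ⟨η', hη', hY⟩ := ξ.exists_lie_eq_tangentIncl Y
  have hU : (U : Matrix (Fin N) (Fin N) ℂ)ᴴ * U = 1 := Unitary.coe_star_mul_self U
  have hX' := tangentIncl_mfderiv_smul U ξ X
  have hY' := tangentIncl_mfderiv_smul U ξ Y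
  rw [hX] at hX'
  rw [hY] at hY'
  have hmul : ∀ V P Q : Matrix (Fin N) (Fin N) ℂ, Vᴴ * V = 1 →
      V * P * Vᴴ * (V * Q * Vᴴ) = V * (P * Q) * Vᴴ := by
    intro V P Q hV
    calc _ = V * P * (Vᴴ * V) * Q * Vᴴ := by simp only [Matrix.mul_assoc]
      _ = _ := by rw [hV]; simp only [Matrix.mul_assoc, Matrix.mul_one]
  have hlie : ∀ V P Q : Matrix (Fin N) (Fin N) ℂ, Vᴴ * V = 1 →
      V * ⁅P, Q⁆ * Vᴴ = ⁅V * P * Vᴴ, V * Q * Vᴴ⁆ := by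
    intro V P Q hV
    simp only [Ring.lie_def, Matrix.mul_sub, Matrix.sub_mul, hmul _ _ _ hV]
  have hskew : ∀ V P : Matrix (Fin N) (Fin N) ℂ, Pᴴ = -P → (V * P * Vᴴ)ᴴ = -(V * P * Vᴴ) := by
    intro V P hP
    simp [Matrix.conjTranspose_mul, hP, Matrix.mul_assoc]
  rw [hlie _ _ _ hU] at hX' hY'
  rw [kksForm_eq_alphaPairing ξ X Y _ _ hη hη' hX hY,
    kksForm_eq_alphaPairing (U • ξ) _ _ _ _ (hskew _ _ hη) (hskew _ _ hη') hX' hY',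
    ← hlie _ _ _ hU, incl_unitary_smul, alphaPairing, alphaPairing]
  congr 2
  generalize (U : Matrix (Fin N) (Fin N) ℂ) = V at *
  have : (V * ⁅η, η'⁆ * Vᴴ)ᴴ = V * ⁅η, η'⁆ᴴ * Vᴴ := by
    simp [Matrix.conjTranspose_mul, Matrix.mul_assoc]
  rw [this, hmul _ _ _ hU, Matrix.trace_mul_comm, ← Matrix.mul_assoc, hU, Matrix.one_mul]

theorem torus_smul_apply (g : Fin N → Circle) (ξ : Orbit d N) (i j : Fin N) :
    (torusToUnitary N g • ξ).incl i j = (g i : ℂ) * ξ.incl i j * star (g j : ℂ) := by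
  rw [incl_unitary_smul]
  change (Matrix.diagonal (fun k => (g k : ℂ)) * ξ.incl *
    (Matrix.diagonal fun k => (g k : ℂ))ᴴ) i j = _
  rw [Matrix.diagonal_conjTranspose, Matrix.mul_diagonal, Matrix.diagonal_mul]
  rfl

theorem coe_mul_star_coe (z : Circle) : (z : ℂ) * star (z : ℂ) = 1 := by
  rw [show star (z : ℂ) = (starRingEnd ℂ) z from rfl, Complex.mul_conj, Circle.normSq_coe]
  simp

theorem scalarTorus_smul (g : Fin N → Circle) (hg : g ∈ scalarTorus N) (ξ : Orbit d N) :
    torusToUnitary N g • ξ = ξ := by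
  obtain ⟨z, rfl⟩ := hg
  refine Subtype.ext (Matrix.ext fun i j => ?_)
  refine (torus_smul_apply _ ξ i j).trans ?_
  change (z : ℂ) * ξ.incl i j * star (z : ℂ) = ξ.incl i j
  rw [mul_right_comm, coe_mul_star_coe, one_mul]

/-- If `d < N`, no off-diagonal entry vanishes on the whole orbit. -/
theorem exists_incl_apply_ne_zero (hdN : d < N) {i j : Fin N} (hij : i ≠ j) :
    ∃ ξ : Orbit d N, ξ.incl i j ≠ 0 := by
  have hd' : (d : ℂ) ≠ 0 := by exact_mod_cast hd.out.ne'
  have hd1 : 1 ≤ d := hd.out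
  -- The point will be c times the projection onto the span of e_i + e_j and d - 1 further basis
  -- vectors; its (i, j) entry is c/2. There is room for these vectors exactly because d ≤ N - 1.
  have hcard : d - 1 ≤ (Finset.univ \ {i, j} : Finset (Fin N)).card := by
    rw [Finset.card_sdiff_of_subset (Finset.subset_univ _), Finset.card_pair hij, Finset.card_univ,
      Fintype.card_fin]
    omega
  obtain ⟨S, hS, hScard⟩ := Finset.exists_subset_card_eq hcard
  have hiS : i ∉ S := fun h => by simpa using hS h
  have hjS : j ∉ S := fun h => by simpa using hS h
  let D : Matrix (Fin N) (Fin N) ℂ := Matrix.diagonal fun k => if k ∈ S then 1 else 0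
  let v : Fin N → ℂ := Pi.single i 1 + Pi.single j 1
  let Q : Matrix (Fin N) (Fin N) ℂ := (1 / 2 : ℂ) • Matrix.vecMulVec v v
  have hvv : v ⬝ᵥ v = 2 := by
    simp [v, hij, hij.symm]
    norm_num
  have hv : ∀ k, (if k ∈ S then (1 : ℂ) else 0) * v k = 0 := by
    intro k
    split_ifs with hk
    · have h1 : k ≠ i := fun h => hiS (h ▸ hk)
      have h2 : k ≠ j := fun h => hjS (h ▸ hk)
      simp [v, h1, h2]
    · simp
  have hDD : D * D = D := by
    simp only [D, Matrix.diagonal_mul_diagonal]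
    congr 1
    funext k
    split_ifs <;> simp
  have hDQ : D * Q = 0 := by
    ext a b
    simp only [D, Q, Matrix.diagonal_mul, Matrix.smul_apply, Matrix.vecMulVec_apply, smul_eq_mul,
      Matrix.zero_apply]
    linear_combination (1 / 2 * v b) * hv a
  have hQD : Q * D = 0 := by
    ext a b
    simp only [D, Q, Matrix.mul_diagonal, Matrix.smul_apply, Matrix.vecMulVec_apply, smul_eq_mul,
      Matrix.zero_apply]
    linear_combination (1 / 2 * v a) * hv b
  have hQQ : Q * Q = Q := by
    simp only [Q, Matrix.smul_mul, Matrix.mul_smul, Matrix.vecMulVec_mul_vecMulVec, hvv, smul_smul]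
    ext a b
    simp only [Matrix.smul_apply, Matrix.vecMulVec_apply, smul_eq_mul, Pi.smul_apply]
    ring
  have hDH : Dᴴ = D := by
    simp only [D, Matrix.diagonal_conjTranspose]
    congr 1
    funext k
    by_cases hk : k ∈ S <;> simp [hk]
  have hvs : star v = v := by
    funext k
    simp only [v, Pi.star_apply, Pi.add_apply, Pi.single_apply, star_add]
    split_ifs <;> simp
  have hQH : Qᴴ = Q := by
    simp [Q, Matrix.conjTranspose_smul, Matrix.conjTranspose_vecMulVec, hvs]
  refine ⟨⟨((N : ℂ) / d) • (D + Q), (isOrbitMatrix_iff hd.out hN.out _).2 ⟨?_, ?_, ?_⟩⟩, ?_⟩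
  · rw [Matrix.IsHermitian, Matrix.conjTranspose_smul, Matrix.conjTranspose_add, hDH, hQH]
    simp
  · rw [Matrix.smul_mul, Matrix.mul_smul, Matrix.add_mul, Matrix.mul_add, Matrix.mul_add, hDD, hDQ,
      hQD, hQQ, add_zero, zero_add]
  · have hQ : Q.trace = 1 := by
      simp [Q, Matrix.trace_smul, Matrix.trace_vecMulVec, hvv]
    have hD : D.trace = (d : ℂ) - 1 := by
      simp only [D, Matrix.trace_diagonal, Finset.sum_boole]
      simp [hScard, Nat.cast_sub hd1]
    rw [Matrix.trace_smul, Matrix.trace_add, hD, hQ, smul_eq_mul]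
    field_simp
    ring
  · change (((N : ℂ) / d) • (D + Q)) i j ≠ 0
    have hN' : N ≠ 0 := by omega
    simp [D, Q, v, Matrix.vecMulVec_apply, hij, hij.symm, hd.out.ne', hN']

end Orbit

/-! ### The action of the effective torus -/

namespace EffTorus

variable {d n : ℕ}

/-- The `v`-component of the momentum map as a linear function of the matrix. -/
def momentumCLM (v : GroupLieAlgebra (torusModel (Fin n)) (EffTorus n)) :
    Matrix (Fin (n + 1)) (Fin (n + 1)) ℂ →L[ℝ] ℝ :=
  (1 / 2 : ℝ) • ∑ k : Fin n, angle k v • (Complex.reCLM ∘L entryCLM k.castSucc k.castSucc)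

theorem momentumCLM_apply (v : GroupLieAlgebra (torusModel (Fin n)) (EffTorus n))
    (X : Matrix (Fin (n + 1)) (Fin (n + 1)) ℂ) :
    momentumCLM v X = 1 / 2 * ∑ k : Fin n, (X k.castSucc k.castSucc).re * angle k v := by
  simp [momentumCLM, entryCLM_apply, mul_comm]

theorem dualOfCoords_momentum (v : GroupLieAlgebra (torusModel (Fin n)) (EffTorus n))
    (ξ : Orbit d (n + 1)) : dualOfCoords n ξ.momentum v = momentumCLM v ξ.incl := by
  rw [dualOfCoords_apply, momentumCLM_apply]
  rfl

variable [hd : Fact (0 < d)] [hN : Fact (d ≤ n + 1)]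

theorem smul_eq (g : EffTorus n) (ξ : Orbit d (n + 1)) :
    g • ξ = torusToUnitary (n + 1) (incl n g) • ξ := rfl

/-- Acting by g multiplies the entry in row k and last column by g_k, because the last entry of g is
1. A point where that entry is nonzero recovers g_k. -/
theorem faithfulSMul (hdn : d < n + 1) : FaithfulSMul (EffTorus n) (Orbit d (n + 1)) where
  eq_of_smul_eq_smul {g h} hgh := by
    funext k
    obtain ⟨ξ, hξ⟩ := Orbit.exists_incl_apply_ne_zero (d := d) hdn (Fin.castSucc_lt_last k).ne
    have := congrArg (fun ζ : Orbit d (n + 1) => ζ.incl k.castSucc (Fin.last n)) (hgh ξ)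
    simp only [smul_eq, Orbit.torus_smul_apply, incl_castSucc, incl_last] at this
    simp [hξ] at this
    exact Circle.ext this

variable (n) in
/-- The diagonal matrix of an element of `G`. -/
def toMatrix (g : EffTorus n) : Matrix (Fin (n + 1)) (Fin (n + 1)) ℂ :=
  Matrix.diagonal fun k => (incl n g k : ℂ)

theorem contMDiff_coe_incl :
    ContMDiff (torusModel (Fin n)) 𝓘(ℝ, Fin (n + 1) → ℂ) ∞
      (fun (g : EffTorus n) (k : Fin (n + 1)) => (incl n g k : ℂ)) := by
  rw [contMDiff_pi_space]
  intro k
  refine Fin.lastCases ?_ (fun i => ?_) k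
  · simp only [incl_last]
    exact contMDiff_const
  · simp only [incl_castSucc]
    exact contMDiff_coe_apply i

theorem contMDiff_toMatrix : ContMDiff (torusModel (Fin n))
    𝓘(ℝ, Matrix (Fin (n + 1)) (Fin (n + 1)) ℂ) ∞ (toMatrix n) :=
  (diagonalCLM (Fin (n + 1))).contMDiff.comp contMDiff_coe_incl

/-- In the space of matrices the action is (D, ξ) ↦ D ξ Dᴴ, jointly smooth by bilinearity of the
product. -/
theorem contMDiffSMul :
    ContMDiffSMul (torusModel (Fin n)) 𝓘(ℝ, OrbitModel d (n + 1)) ∞ (EffTorus n)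
      (Orbit d (n + 1)) where
  contMDiff_smul := by
    refine Orbit.contMDiff_of_incl_comp ?_
    have h1 := contMDiff_toMatrix (n := n).comp (contMDiff_fst (I := torusModel (Fin n))
      (J := 𝓘(ℝ, OrbitModel d (n + 1))) (M := EffTorus n) (N := Orbit d (n + 1)))
    have h2 := (Orbit.contMDiff_incl (d := d) (N := n + 1)).comp
      (contMDiff_snd (I := torusModel (Fin n))
        (J := 𝓘(ℝ, OrbitModel d (n + 1))) (M := EffTorus n) (N := Orbit d (n + 1)))
    have hm := (isBoundedBilinearMap_matrix_mul (l := Fin (n + 1)) (m := Fin (n + 1))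
      (k := Fin (n + 1))).contDiff (n := ∞)
    have h3 := hm.contMDiff.comp (h1.prodMk_space h2)
    have h4 := (conjTransposeCLM (Fin (n + 1)) (Fin (n + 1))).contMDiff.comp h1
    exact hm.contMDiff.comp (h3.prodMk_space h4)

/-- The Lie algebra element `v` as the matrix `diag(i θ_1, …, i θ_n, 0)`. -/
def lieMatrix (v : GroupLieAlgebra (torusModel (Fin n)) (EffTorus n)) :
    Matrix (Fin (n + 1)) (Fin (n + 1)) ℂ :=
  Matrix.diagonal (Fin.snoc (α := fun _ => ℂ) (fun k => Complex.I * ((angle k v : ℝ) : ℂ)) 0)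

theorem conjTranspose_lieMatrix (v : GroupLieAlgebra (torusModel (Fin n)) (EffTorus n)) :
    (lieMatrix v)ᴴ = -lieMatrix v := by
  rw [lieMatrix, Matrix.diagonal_conjTranspose, Matrix.diagonal_neg]
  congr 1
  funext k
  refine Fin.lastCases ?_ (fun i => ?_) k <;> simp

theorem mfderiv_toMatrix (v : GroupLieAlgebra (torusModel (Fin n)) (EffTorus n)) :
    (mfderiv (torusModel (Fin n)) 𝓘(ℝ, Matrix (Fin (n + 1)) (Fin (n + 1)) ℂ) (toMatrix n) 1 v :
      Matrix (Fin (n + 1)) (Fin (n + 1)) ℂ) = lieMatrix v := by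
  have hd := (contMDiff_coe_incl (n := n) 1).mdifferentiableAt (by simp)
  refine ((diagonalCLM (Fin (n + 1))).hasFDerivAt.mfderiv_comp_apply hd v).trans ?_
  refine congrArg Matrix.diagonal (funext fun k => ?_)
  have hk := (ContinuousLinearMap.proj (R := ℝ) (φ := fun _ : Fin (n + 1) => ℂ)
    k).hasFDerivAt.mfderiv_comp_apply hd v
  refine Eq.trans hk.symm ?_
  refine Fin.lastCases ?_ (fun i => ?_) k
  · have h : (fun g : EffTorus n => (incl n g (Fin.last n) : ℂ)) = fun _ => 1 := by
      funext g
      rw [incl_last]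
      rfl
    rw [Fin.snoc_last]
    exact (mfderiv_apply_congr h 1 v).trans (mfderiv_const_apply 1 1 v)
  · have h : (fun g : EffTorus n => (incl n g i.castSucc : ℂ)) = fun g => (g i : ℂ) := by
      funext g
      rw [incl_castSucc]
    rw [Fin.snoc_castSucc]
    exact (mfderiv_apply_congr h 1 v).trans (mfderiv_coe_apply_one i v)

theorem toMatrix_one : toMatrix n 1 = 1 := by
  simp [toMatrix]

theorem contDiff_conjugate {N : ℕ} (ξ : Matrix (Fin N) (Fin N) ℂ) :
    ContDiff ℝ ∞ (fun D : Matrix (Fin N) (Fin N) ℂ => D * ξ * Dᴴ) := by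
  rw [← contDiffOn_univ]
  exact (contDiffOn_id.matrix_mul contDiffOn_const).matrix_mul contDiffOn_id.matrix_conjTranspose

theorem hasFDerivAt_conjugate_one {N : ℕ} (ξ : Matrix (Fin N) (Fin N) ℂ) :
    ∃ L : Matrix (Fin N) (Fin N) ℂ →L[ℝ] Matrix (Fin N) (Fin N) ℂ,
      HasFDerivAt (fun D : Matrix (Fin N) (Fin N) ℂ => D * ξ * Dᴴ) L 1 ∧
        ∀ V, L V = V * ξ + ξ * Vᴴ := by
  have hf := (((contDiff_conjugate ξ).differentiable (by simp)).differentiableAt (x := 1)).hasFDerivAt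
  refine ⟨_, hf, fun V => ?_⟩
  have hV : HasDerivAt (fun t : ℝ => 1 + t • V) V 0 := by
    simpa using ((hasDerivAt_id (0 : ℝ)).smul_const V).const_add 1
  have h := (hV.matrix_mul (hasDerivAt_const (0 : ℝ) ξ)).matrix_mul hV.matrix_conjTranspose
  refine ((hf.hasLineDerivAt V).unique h).trans ?_
  simp

theorem contMDiff_smul_const (ξ : Orbit d (n + 1)) :
    ContMDiff (torusModel (Fin n)) 𝓘(ℝ, OrbitModel d (n + 1)) ∞ (fun g : EffTorus n => g • ξ) :=
  Orbit.contMDiff_of_incl_comp ((contDiff_conjugate ξ.incl).contMDiff.comp contMDiff_toMatrix)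

/-- The derivative of D ↦ D ξ Dᴴ at 1 is V ↦ Vξ + ξVᴴ, a commutator when V is skew-Hermitian. -/
theorem tangentIncl_fundamentalField (v : GroupLieAlgebra (torusModel (Fin n)) (EffTorus n))
    (ξ : Orbit d (n + 1)) :
    ξ.tangentIncl (fundamentalField (torusModel (Fin n)) v ξ) = ⁅lieMatrix v, ξ.incl⁆ := by
  obtain ⟨L, hL, hLV⟩ := hasFDerivAt_conjugate_one ξ.incl
  rw [← toMatrix_one] at hL
  have h1 := mfderiv_comp_apply_of_eq (x := (1 : EffTorus n)) (Orbit.mdifferentiableAt_incl ξ)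
    ((contMDiff_smul_const ξ 1).mdifferentiableAt (by simp)) (one_smul _ ξ) v
  have h2 := hL.mfderiv_comp_apply ((contMDiff_toMatrix (n := n) 1).mdifferentiableAt (by simp)) v
  rw [mfderiv_toMatrix, hLV, conjTranspose_lieMatrix, Matrix.mul_neg, ← sub_eq_add_neg] at h2
  exact h1.symm.trans h2

/-- By `alphaPairing_lie` the left side is Re(-(i/2) tr(DY)) with D = diag(iθ_1, …, iθ_n, 0). The
factors i combine to θ_k/2, and the zero in D removes the last diagonal entry of Y. -/
theorem hamilton (v : GroupLieAlgebra (torusModel (Fin n)) (EffTorus n)) (ξ : Orbit d (n + 1))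
    (Y : TangentSpace 𝓘(ℝ, OrbitModel d (n + 1)) ξ) :
    Orbit.kksForm d (n + 1) ξ ![fundamentalField (torusModel (Fin n)) v ξ, Y] =
      1 / 2 * ∑ k : Fin n, (ξ.tangentIncl Y k.castSucc k.castSucc).re * angle k v := by
  obtain ⟨η, hη, hY⟩ := ξ.exists_lie_eq_tangentIncl Y
  rw [Orbit.kksForm_eq_alphaPairing ξ _ Y _ _ (conjTranspose_lieMatrix v) hη
    (tangentIncl_fundamentalField v ξ) hY, alphaPairing_lie _ (conjTranspose_lieMatrix v) hη, ← hY,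
    Matrix.trace]
  simp only [Matrix.diag_apply, lieMatrix, Matrix.diagonal_mul, Fin.sum_univ_castSucc,
    Fin.snoc_castSucc, Fin.snoc_last, zero_mul, add_zero, Finset.mul_sum, Complex.re_sum]
  refine Finset.sum_congr rfl fun k _ => ?_
  generalize ξ.tangentIncl Y k.castSucc k.castSucc = z
  rw [show -(Complex.I / 2) * (Complex.I * ((angle k v : ℝ) : ℂ) * z) =
    -(Complex.I * Complex.I) * (((1 / 2 * angle k v : ℝ) : ℂ) * z) by push_cast; ring,
    Complex.I_mul_I, neg_neg, one_mul, Complex.re_ofReal_mul]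
  ring

theorem momentum_smul (g : EffTorus n) (ξ : Orbit d (n + 1)) :
    (g • ξ).momentum = ξ.momentum := by
  funext k
  simp only [Orbit.momentum, smul_eq, Orbit.torus_smul_apply]
  rw [mul_right_comm, Orbit.coe_mul_star_coe, one_mul]

theorem lieAd_eq (g : EffTorus n) (v : GroupLieAlgebra (torusModel (Fin n)) (EffTorus n)) :
    lieAd (torusModel (Fin n)) g v = v := by
  -- Conjugation is the identity because the group is abelian. A variable `f` allows the
  -- substitution, since the type of the derivative depends on the map.
  have h : ∀ f : EffTorus n → EffTorus n, f = id →
      (mfderiv (torusModel (Fin n)) (torusModel (Fin n)) f 1 v : Fin n → EuclideanSpace ℝ (Fin 1)) =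
        v := by
    rintro _ rfl
    rw [mfderiv_id]
    rfl
  exact h _ (funext fun h => by simp)

theorem isHamiltonianAction :
    IsHamiltonianAction (torusModel (Fin n)) (Orbit.kksForm d (n + 1))
      (fun ξ : Orbit d (n + 1) => dualOfCoords n ξ.momentum) where
  isSymplectic := Orbit.isSymplectic_kksForm
  smooth_smul := contMDiffSMul
  invariant g := Orbit.kksForm_unitary_smul (torusToUnitary (n + 1) (incl n g))
  smooth_momentum v := by
    simp only [dualOfCoords_momentum]
    exact (momentumCLM v).contMDiff.comp Orbit.contMDiff_incl
  hamilton v ξ Y := by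
    rw [hamilton, ← momentumCLM_apply]
    have h : (fun ξ : Orbit d (n + 1) => dualOfCoords n ξ.momentum v) =
        fun ξ => momentumCLM v ξ.incl := funext (dualOfCoords_momentum v)
    exact (((mfderiv_apply_congr h ξ Y).trans
      ((momentumCLM v).hasFDerivAt.mfderiv_comp_apply (Orbit.mdifferentiableAt_incl ξ) Y))).symm
  equivariant g ξ v := by rw [momentum_smul, lieAd_eq]

end EffTorus

theorem TightFrame.momentum_gram {d n : ℕ} [Fact (0 < d)] [Fact (d ≤ n + 1)]
    (F : TightFrame d (n + 1)) (k : Fin n) :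
    F.gram.momentum k = ‖WithLp.toLp 2 (fun i => F.mat i k.castSucc)‖ ^ 2 := by
  rw [EuclideanSpace.norm_sq_eq, Orbit.momentum, incl_gram, Matrix.mul_apply, Complex.re_sum]
  refine Finset.sum_congr rfl fun i _ => ?_
  rw [Matrix.conjTranspose_apply, ← Complex.normSq_eq_norm_sq]
  simp [Complex.normSq_apply]

end

theorem mainTheorem7 (n d : ℕ) [Fact (0 < d)] [Fact (d ≤ n + 1)] :
    -- `𝒪_{N/d}`, `N = n + 1`, is a coadjoint orbit of `U(N)`, and `𝒪_{N/d} ≈ ℱ_{N/d} / U(d)`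
    IsCoadjointOrbit d (n + 1) ∧
    GramIsSymplectomorphism d (n + 1) ∧
    -- `G` is `U(1)^N / U(1)`, the scalars act trivially, the action of `G` is effective if `d < N`
    Function.Bijective (fun g : EffTorus n =>
      (QuotientGroup.mk (EffTorus.incl n g) : (Fin (n + 1) → Circle) ⧸ scalarTorus (n + 1))) ∧
    (∀ g ∈ scalarTorus (n + 1), ∀ ξ : Orbit d (n + 1), torusToUnitary (n + 1) g • ξ = ξ) ∧
    (d < n + 1 → FaithfulSMul (EffTorus n) (Orbit d (n + 1))) ∧
    -- `ℝ^{N-1} ≈ 𝔤*`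
    Function.Bijective (EffTorus.dualOfCoords n) ∧
    -- the action is Hamiltonian with momentum map `Φ_G`
    IsHamiltonianAction (torusModel (Fin n)) (Orbit.kksForm d (n + 1))
      (fun ξ : Orbit d (n + 1) => EffTorus.dualOfCoords n ξ.momentum) ∧
    -- and `Φ_G (Fᴴ F) = (‖f_1‖², …, ‖f_{N-1}‖²)`
    ∀ (F : TightFrame d (n + 1)) (k : Fin n),
      F.gram.momentum k = ‖WithLp.toLp 2 (fun i => F.mat i k.castSucc)‖ ^ 2 := by
  exact ⟨isCoadjointOrbit d (n + 1), gramIsSymplectomorphism d (n + 1),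
    EffTorus.mk_incl_bijective, Orbit.scalarTorus_smul, EffTorus.faithfulSMul,
    EffTorus.dualOfCoords_bijective, EffTorus.isHamiltonianAction, TightFrame.momentum_gram⟩
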